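/- **Lemma (polynomial encoding length).** An instance consists of $n$ jobs $N=\{1,\dots,n\}$ with rational processing times $p_j\ge 0$ and weights $w_j\ge 0$, an acyclic set $A\subset N\times N$ of precedence arcs, and $m\ge 1$ identical machines. Its encoding length $L$ is the length of a binary encoding of all these data; a rational number is encoded by sign, numerator and denominator in lowest terms. For $U\subseteq N$ let $F(U)$ be the set of jobs of $U$ without predecessor in $U$. *Virtual schedule loop.* Start with $t=0$, $U=N$, $Y_j=0$ for all $j$. While $U\ne\emptyset$: determine rates $R_i\ge 0$ for $i\in F=F(U)$ (see below); set $\tau_i=(p_i-Y_i)/R_i$ for $i\in F$ (with $\tau_i=\infty$ if $R_i=0$); choose $j\in F$ with $R_j>0$ and $\tau_j$ minimal; replace $Y_i$ by $Y_i+R_i\tau_j$ for all $i\in F$, $t$ by $t+\tau_j$, $U$ by $U\setminus\{j\}$; set $C_j'=t$. *Parallel machines (Algorithm 4, with Algorithm 2 for the rates).* If $|F|\le m$, then $R_i=1$ for all $i\in F$. Otherwise consider the network with nodes $U\cup\{\mathrm A,\mathrm B,\mathrm Z\}$ and the following arcs and capacities, for a parameter $\pi>0$: $(\mathrm A,\mathrm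 B)$ with capacity $m$; $(\mathrm B,j)$, $j\in F$, with capacity $1$; $(j,k)\in A$, $j,k\in U$, with capacity $\infty$; $(j,\mathrm Z)$, $j\in U$, with capacity $w_j/\pi$. Let $\pi_t$ be the largest real $\pi>0$ for which $\{\mathrm A\}$ defines a minimum-capacity $\mathrm A$-$\mathrm Z$-cut, let $x^t$ be a maximum $\mathrm A$-$\mathrm Z$-flow for $\pi=\pi_t$, and set $R_i=x^t_{(\mathrm B,i)}$ for $i\in F$. Here $x^t$ may be any maximum flow that is integral in the following sense: if $\pi_t=\alpha/\rho$ with natural numbers $\alpha,\rho>0$, and $D$ is the product of the denominators of the weights ($D=1$ for integral weights), then all arc flows are integer multiples of $1/(\alpha D)$, as all finite capacities are. After the loop, order the jobs so that $C_1'\le\dots\le C_n'$ and put $C_0'=0$. For $j=1,\dots,n$ apply the wrap-around rule to $[C'_{j-1},C'_j]$: let $\Delta_k$ be the amount of job $k$ processed by the virtual schedule in this interval; start with $i=1$, $u=C_{j-1}'$, $k=j$. While $k\le n$: if $u+\Delta_k\le C_j'$, process $k$ on machine $i$ during $[u,u+\Delta_k]$, replace $u$ by $u+\Delta_k$ and $k$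 by $k+1$; otherwise process $k$ on machine $i$ during $[u,C_j']$, replace $\Delta_k$ by $u+\Delta_k-C_j'$, $i$ by $i+1$, and $u$ by $C_{j-1}'$. *Single machine (Algorithm 3).* The rates are $R_i=W(i)/W$, where $W=\sum_{j\in U}w_j$ and $W(i)$ is the total weight of a set $T(i)$ of jobs, given either (a) by the subtree rooted at $i$ in a depth-first search forest of $(N,A)$ computed once at the beginning, or (b) in each iteration, by going through $i\in F$ in some order and letting $T(i)$ consist of $i$ and all its direct and indirect successors in $U$ that have not been assigned yet. After the loop, the jobs are processed nonpreemptively without idle time in an order of nondecreasing $C_j'$. There is a polynomial $P$ such that for every instance and every choice of the maximum flows, search forest or orders, and tie-breaking as above, the following holds. 1. In the parallel-machine algorithm, all numbers occurring (the values of $\pi_t$, the finite capacities $w_j/\pi_t$, the flows $x^t$, and $R_i$, $p_i-Y_i$, $\tau_i$, $R_i\tau_j$, $Y_i$, $t$, $C_j'$, and in the wrap-around part $i$, $k$, $u$, $\Delta_k$, $u+\Delta_k$) are rational and have binary encoding length at most $P(L)$. The loop makes at most $n$ iterations, and the wrap-around rule at most $2n$ iterations per interval. 2. In the single-machine algorithm,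 all numbers occurring (the values of $W$, $W(i)$, $R_i$, $p_i-Y_i$, $\tau_i$, $R_i\tau_j$, $Y_i$, $t$, $C_j'$ and the completion times of the final schedule) are rational and have binary encoding length at most $P(L)$, and the loop makes at most $n$ iterations. The bounds also hold for the numbers occurring in any initial part of the loop (if all weights are $0$, for instance, $\pi_t$ need not exist). If from every job a job of positive weight can be reached in $(N,A)$ (the job itself included), then the parallel-machine algorithm and variant (b) of the single-machine algorithm can be carried out to the end, and in particular $\pi_t$ and an integral maximum flow exist whenever required; if all weights are positive, this also holds for variant (a). -/

import Mathlib

open scoped ENNReal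

noncomputable section

namespace PrecSched

/-! ### Encoding lengths -/

/-- Binary encoding length of a rational number `a / b` in lowest terms: one sign bit and the binary
digits of `|a|` and of `b`. -/
def ratLen (q : ℚ) : ℕ := 1 + Nat.size q.num.natAbs + Nat.size q.den

/-- The real number `a` is rational and its binary encoding length is at most `b`. -/
def EncodedWithin (b : ℕ) (a : ℝ) : Prop := ∃ q : ℚ, (q : ℝ) = a ∧ ratLen q ≤ b

/-! ### Instances -/

/-- An instance with job set `Fin n`: `m ≥ 1` identical machines, rational processing times
`p j ≥ 0` and weights `w j ≥ 0`, and a directed acyclic graph of precedence constraints. -/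
structure Inst (n : ℕ) where
  m : ℕ
  m_pos : 1 ≤ m
  p : Fin n → ℚ
  p_nonneg : ∀ j, 0 ≤ p j
  w : Fin n → ℚ
  w_nonneg : ∀ j, 0 ≤ w j
  prec : Finset (Fin n × Fin n)
  acyclic : ∀ j, ¬ Relation.TransGen (fun a b => (a, b) ∈ prec) j j

namespace Inst

variable {n : ℕ} (I : Inst n)

/-- Input encoding length: the jobs, the number of machines, the processing times and weights, and
the arcs, each given by the binary names of its two ends. -/
def encLen : ℕ :=
  n + Nat.size I.m + ∑ j, (ratLen (I.p j) + ratLen (I.w j)) + I.prec.card * (2 * Nat.size n)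

/-- The jobs of `U` that have no predecessor in `U` (the available jobs, if `U` is the set of
unfinished jobs). -/
def avail (U : Finset (Fin n)) : Finset (Fin n) :=
  U.filter fun j => ∀ i ∈ U, (i, j) ∉ I.prec

/-- `j` is `i` itself or a direct or indirect successor of `i`. -/
def Reaches (i j : Fin n) : Prop := Relation.ReflTransGen (fun a b => (a, b) ∈ I.prec) i j

end Inst

/-! ### The parametric network -/

/-- The possible nodes of the network: the three extra nodes `A`, `B`, `Z` and the jobs. -/
inductive Node (n : ℕ) where
  | A : Node n
  | B : Node n
  | Z : Node n
  | job (j : Fin n) : Node n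
  deriving DecidableEq

section Network

variable {n : ℕ} (I : Inst n) (U : Finset (Fin n))

/-- The nodes of the network for the set `U` of unfinished jobs. -/
def nodes : Finset (Node n) := U.image Node.job ∪ {Node.A, Node.B, Node.Z}

/-- The arcs of the network for the set `U` of unfinished jobs. -/
def arcs : Finset (Node n × Node n) :=
  ((I.prec.filter fun e => e.1 ∈ U ∧ e.2 ∈ U).image fun e => (Node.job e.1, Node.job e.2)) ∪
    {(Node.A, Node.B)} ∪
    ((I.avail U).image fun j => (Node.B, Node.job j)) ∪
    (U.image fun j => (Node.job j, Node.Z))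

/-- The arc capacities for the parameter `pi` (only the values on arcs matter). -/
def capacity (pi : ℝ) : Node n × Node n → ℝ≥0∞
  | (Node.A, Node.B) => (I.m : ℝ≥0∞)
  | (Node.B, Node.job _) => 1
  | (Node.job _, Node.job _) => ⊤
  | (Node.job j, Node.Z) => ENNReal.ofReal ((I.w j : ℝ) / pi)
  | _ => 0

/-- The capacity of the cut `(S, V \ S)`. -/
def cutCapacity (pi : ℝ) (S : Finset (Node n)) : ℝ≥0∞ :=
  ∑ a ∈ (arcs I U).filter (fun a => a.1 ∈ S ∧ a.2 ∉ S), capacity I pi a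

/-- `(S, V \ S)` is a minimum-capacity cut that separates `A` from `Z`. -/
def IsMinCut (pi : ℝ) (S : Finset (Node n)) : Prop :=
  (S ⊆ nodes U ∧ Node.A ∈ S ∧ Node.Z ∉ S) ∧
    ∀ S' ⊆ nodes U, Node.A ∈ S' → Node.Z ∉ S' → cutCapacity I U pi S ≤ cutCapacity I U pi S'

/-- `x` is a feasible flow from `A` to `Z` for the parameter `pi`. -/
structure IsFlow (pi : ℝ) (x : Node n × Node n → ℝ) : Prop where
  nonneg : ∀ a ∈ arcs I U, 0 ≤ x a
  le_capacity : ∀ a ∈ arcs I U, ENNReal.ofReal (x a) ≤ capacity I pi a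
  conservation : ∀ v ∈ nodes U, v ≠ Node.A → v ≠ Node.Z →
    ∑ a ∈ (arcs I U).filter (fun a => a.2 = v), x a =
      ∑ a ∈ (arcs I U).filter (fun a => a.1 = v), x a

/-- The flow value (no arc enters `A`). -/
def flowValue (x : Node n × Node n → ℝ) : ℝ :=
  ∑ a ∈ (arcs I U).filter (fun a => a.1 = Node.A), x a

/-- `x` is a maximum flow from `A` to `Z` for the parameter `pi`. -/
def IsMaxFlow (pi : ℝ) (x : Node n × Node n → ℝ) : Prop :=
  IsFlow I U pi x ∧ ∀ y, IsFlow I U pi y → flowValue I U y ≤ flowValue I U x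

/-- `pi` is the largest positive real number for which `({A}, V \ {A})` is a minimum-capacity cut. -/
def IsPrice (pi : ℝ) : Prop :=
  IsGreatest {q : ℝ | 0 < q ∧ IsMinCut I U q {Node.A}} pi

/-- The product of the denominators of the weights; it is `1` if the weights are integers. -/
def weightDen : ℕ := ∏ j, (I.w j).den

/-- If the parameter is written as a fraction `pi = α / ρ`, then every arc flow is an integer
multiple of `1 / (α * D)`, where `D` is the common denominator `weightDen` of the weights; all
finite arc capacities are such multiples. For integral weights these are the multiples of
`1 / α`. -/
def IsIntegralFlow (pi : ℝ) (x : Node n × Node n → ℝ) : Prop :=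
  ∀ α ρ : ℕ, 0 < ρ → pi = (α : ℝ) / (ρ : ℝ) →
    ∀ a ∈ arcs I U, ∃ z : ℤ, x a * ((α : ℝ) * (weightDen I : ℝ)) = (z : ℝ)

end Network

/-! ### The loop that computes a virtual schedule -/

/-- The values of the variables during the first `len` iterations of the loop that computes a
virtual schedule. `t k`, `U k`, `Y k` are the clock, the unfinished jobs and the elapsed processing
times at the beginning of iteration `k` (counted from `0`), `R k` are the rates of iteration `k`,
`job k` is the job that it completes, and `C` are the virtual completion times. -/
structure Trace (n : ℕ) where
  len : ℕ
  t : ℕ → ℝ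
  U : ℕ → Finset (Fin n)
  Y : ℕ → Fin n → ℝ
  R : ℕ → Fin n → ℝ
  job : Fin len → Fin n
  C : Fin n → ℝ

section VirtualSchedule

variable {n : ℕ} (I : Inst n) (T : Trace n)

/-- `τ_i` in iteration `k`, used only for `R k i > 0`. -/
def Trace.tau (k : ℕ) (i : Fin n) : ℝ := ((I.p i : ℝ) - T.Y k i) / T.R k i

/-- The trace obeys the loop; how the rates are chosen is left to the algorithm at hand. Jobs of
rate `0` have `τ_i = ∞`, so the minimum of the `τ_i` is taken over the available jobs of positive
rate. -/
structure ObeysLoop : Prop where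
  t_zero : T.t 0 = 0
  U_zero : T.U 0 = Finset.univ
  Y_zero : ∀ i, T.Y 0 i = 0
  job_mem : ∀ k : Fin T.len, T.job k ∈ I.avail (T.U k)
  rate_pos : ∀ k : Fin T.len, 0 < T.R k (T.job k)
  job_min : ∀ k : Fin T.len, ∀ i ∈ I.avail (T.U k), 0 < T.R k i →
    T.tau I k (T.job k) ≤ T.tau I k i
  Y_avail : ∀ k : Fin T.len, ∀ i ∈ I.avail (T.U k),
    T.Y (k + 1) i = T.Y k i + T.R k i * T.tau I k (T.job k)
  Y_other : ∀ k : Fin T.len, ∀ i, i ∉ I.avail (T.U k) → T.Y (k + 1) i = T.Y k i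
  t_succ : ∀ k : Fin T.len, T.t (k + 1) = T.t k + T.tau I k (T.job k)
  U_succ : ∀ k : Fin T.len, T.U (k + 1) = (T.U k).erase (T.job k)
  C_job : ∀ k : Fin T.len, T.C (T.job k) = T.t (k + 1)

/-- The loop has terminated. -/
def Trace.Complete : Prop := T.U T.len = ∅

/-- The numbers that occur in the loop, whatever the rule for the rates. -/
inductive LoopNumber : ℝ → Prop
  | clock (k : ℕ) (hk : k ≤ T.len) : LoopNumber (T.t k)
  | elapsed (k : ℕ) (hk : k ≤ T.len) (i : Fin n) : LoopNumber (T.Y k i)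
  | rate (k : ℕ) (hk : k < T.len) (i : Fin n) (hi : i ∈ I.avail (T.U k)) : LoopNumber (T.R k i)
  | remaining (k : ℕ) (hk : k < T.len) (i : Fin n) (hi : i ∈ I.avail (T.U k)) :
      LoopNumber ((I.p i : ℝ) - T.Y k i)
  | tau (k : ℕ) (hk : k < T.len) (i : Fin n) (hi : i ∈ I.avail (T.U k)) (hR : 0 < T.R k i) :
      LoopNumber (T.tau I k i)
  | increment (k : Fin T.len) (i : Fin n) (hi : i ∈ I.avail (T.U k)) :
      LoopNumber (T.R k i * T.tau I k (T.job k))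
  | completion (k : Fin T.len) : LoopNumber (T.C (T.job k))

end VirtualSchedule

/-! ### The algorithm for identical parallel machines -/

/-- The first `len` iterations of the virtual-schedule loop on identical parallel machines, with
rates given by the parametric flow computation. `price k` and `flow k` are the parameter and the
maximum flow computed in iteration `k` if there are more than `m` available jobs. -/
structure ParallelRun {n : ℕ} (I : Inst n) extends Trace n where
  price : ℕ → ℝ
  flow : ℕ → Node n × Node n → ℝ
  obeys : ObeysLoop I toTrace
  rate_few : ∀ k < len, (I.avail (U k)).card ≤ I.m → ∀ i ∈ I.avail (U k), R k i = 1
  price_spec : ∀ k < len, I.m < (I.avail (U k)).card → IsPrice I (U k) (price k)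
  flow_max : ∀ k < len, I.m < (I.avail (U k)).card → IsMaxFlow I (U k) (price k) (flow k)
  flow_integral : ∀ k < len, I.m < (I.avail (U k)).card →
    IsIntegralFlow I (U k) (price k) (flow k)
  rate_many : ∀ k < len, I.m < (I.avail (U k)).card →
    ∀ i ∈ I.avail (U k), R k i = flow k (Node.B, Node.job i)

/-- The numbers that occur in the computation of the virtual schedule on parallel machines. -/
inductive ParallelNumber {n : ℕ} {I : Inst n} (T : ParallelRun I) : ℝ → Prop
  | loop (a : ℝ) (ha : LoopNumber I T.toTrace a) : ParallelNumber T a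
  | price (k : ℕ) (hk : k < T.len) (h : I.m < (I.avail (T.U k)).card) :
      ParallelNumber T (T.price k)
  | capacity (k : ℕ) (hk : k < T.len) (h : I.m < (I.avail (T.U k)).card)
      (a : Node n × Node n) (ha : a ∈ arcs I (T.U k)) (hfin : capacity I (T.price k) a ≠ ⊤) :
      ParallelNumber T (capacity I (T.price k) a).toReal
  | flow (k : ℕ) (hk : k < T.len) (h : I.m < (I.avail (T.U k)).card)
      (a : Node n × Node n) (ha : a ∈ arcs I (T.U k)) : ParallelNumber T (T.flow k a)

/-! ### The wrap-around rule -/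

/-- The variables `i` (current machine), `u` (current time), `k` (position of the current job, from
`0`) and `Δ` (its processing amount still to be assigned) of the inner wrap-around loop. -/
structure WrapState where
  i : ℕ
  u : ℝ
  k : ℕ
  Δ : ℝ

section WrapAround

variable {n : ℕ} (T : Trace n) (σ : Equiv.Perm (Fin n))

/-- The left end of the `j`-th interval (from `0`), when `σ` lists the jobs by nondecreasing virtual
completion time: `0` or the previous virtual completion time. -/
def intervalStart (j : Fin n) : ℝ :=
  if (j : ℕ) = 0 then 0 else T.C (σ ⟨(j : ℕ) - 1, lt_of_le_of_lt (Nat.sub_le _ _) j.2⟩)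

/-- The right end of the `j`-th interval. -/
def intervalEnd (j : Fin n) : ℝ := T.C (σ j)

/-- The amount of job `i` processed by the virtual schedule in the `j`-th interval. The ends of this
interval are the clock values before and after iteration `j`, because the clock never decreases;
iterations that leave the clock unchanged also leave `Y` unchanged, so ties are harmless. -/
def amount (j : Fin n) (i : Fin n) : ℝ := T.Y ((j : ℕ) + 1) i - T.Y (j : ℕ) i

/-- The state at the start of the inner loop for the `j`-th interval. -/
def wrapInit (j : Fin n) : WrapState := ⟨1, intervalStart T σ j, (j : ℕ), amount T j (σ j)⟩

/-- One iteration of the inner loop for the `j`-th interval (no change once all jobs are done). -/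
def wrapStep (j : Fin n) (s : WrapState) : WrapState :=
  if s.k < n then
    if s.u + s.Δ ≤ intervalEnd T σ j then
      ⟨s.i, s.u + s.Δ, s.k + 1, if h : s.k + 1 < n then amount T j (σ ⟨s.k + 1, h⟩) else s.Δ⟩
    else
      ⟨s.i + 1, intervalStart T σ j, s.k, s.u + s.Δ - intervalEnd T σ j⟩
  else s

/-- The state after `r` iterations of the inner loop for the `j`-th interval. -/
def wrapState (j : Fin n) (r : ℕ) : WrapState := (wrapStep T σ j)^[r] (wrapInit T σ j)

/-- The numbers that occur in the wrap-around part, in particular all start and end times of the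
pieces of the actual schedule. -/
inductive WrapNumber : ℝ → Prop
  | left (j : Fin n) : WrapNumber (intervalStart T σ j)
  | right (j : Fin n) : WrapNumber (intervalEnd T σ j)
  | machine (j : Fin n) (r : ℕ) : WrapNumber (((wrapState T σ j r).i : ℕ) : ℝ)
  | position (j : Fin n) (r : ℕ) : WrapNumber (((wrapState T σ j r).k : ℕ) : ℝ)
  | time (j : Fin n) (r : ℕ) : WrapNumber (wrapState T σ j r).u
  | rest (j : Fin n) (r : ℕ) : WrapNumber (wrapState T σ j r).Δ
  | sum (j : Fin n) (r : ℕ) (hr : (wrapState T σ j r).k < n) :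
      WrapNumber ((wrapState T σ j r).u + (wrapState T σ j r).Δ)

end WrapAround

/-! ### The algorithm for a single machine -/

section SingleMachine

variable {n : ℕ} (I : Inst n)

open Classical in
/-- The set assigned to the available job `i` when the available jobs are considered in the order
`e`, each taking all of its yet unassigned unfinished successors and itself. -/
def greedyTree (e : Equiv.Perm (Fin n)) (U : Finset (Fin n)) (i : Fin n) : Finset (Fin n) :=
  U.filter fun j => I.Reaches i j ∧ ∀ l ∈ I.avail U, e l < e i → ¬ I.Reaches l j

/-- Depth-first search from `v` along adjacency lists. The state holds the visited nodes and, for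
every node, the node set of its subtree in the search forest. The first argument bounds the depth
of the recursion. -/
def dfsVisit (adj : Fin n → List (Fin n)) :
    ℕ → Fin n → Finset (Fin n) × (Fin n → Finset (Fin n)) →
      Finset (Fin n) × (Fin n → Finset (Fin n))
  | 0, _, s => s
  | f + 1, v, s =>
    if v ∈ s.1 then s
    else
      let r := (adj v).foldl (fun s' c => dfsVisit adj f c s') (insert v s.1, s.2)
      (r.1, Function.update r.2 v (r.1 \ s.1))

/-- The node set of the subtree rooted at `v` in the depth-first search forest when the nodes are
tried as roots in the order of the list `roots`. (Depth `n` suffices in an acyclic graph.) -/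
def dfsSubtree (roots : List (Fin n)) (adj : Fin n → List (Fin n)) (v : Fin n) :
    Finset (Fin n) :=
  (roots.foldl (fun s r => dfsVisit adj n r s) (∅, fun _ => ∅)).2 v

/-- The sets whose total weight is `W(i)` are the subtrees of one depth-first search forest of the
whole precedence graph. -/
def IsDfsRule (rule : ℕ → Finset (Fin n) → Fin n → Finset (Fin n)) : Prop :=
  ∃ (roots : List (Fin n)) (adj : Fin n → List (Fin n)),
    (∀ v, v ∈ roots) ∧ (∀ v c, c ∈ adj v ↔ (v, c) ∈ I.prec) ∧
      ∀ k U i, rule k U i = dfsSubtree roots adj i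

/-- The sets whose total weight is `W(i)` are those of the greedy assignment, recomputed in every
iteration `k` for the current set `U` of unfinished jobs. -/
def IsGreedyRule (rule : ℕ → Finset (Fin n) → Fin n → Finset (Fin n)) : Prop :=
  ∃ e : ℕ → Equiv.Perm (Fin n), ∀ k U i, rule k U i = greedyTree I (e k) U i

/-- The total weight of a set of jobs. -/
def totalWeight (J : Finset (Fin n)) : ℝ := ∑ j ∈ J, (I.w j : ℝ)

/-- The first `len` iterations of the virtual-schedule loop on a single machine (`I.m` is ignored),
with the rates `W(i) / W`, where `W(i)` is the total weight of `rule k U i`. -/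
structure SingleRun (rule : ℕ → Finset (Fin n) → Fin n → Finset (Fin n)) extends Trace n where
  obeys : ObeysLoop I toTrace
  rate : ∀ k < len, ∀ i ∈ I.avail (U k),
    R k i = totalWeight I (rule k (U k) i) / totalWeight I (U k)

/-- The numbers that occur in the computation of the virtual schedule on a single machine. -/
inductive SingleNumber {I : Inst n} {rule : ℕ → Finset (Fin n) → Fin n → Finset (Fin n)}
    (T : SingleRun I rule) : ℝ → Prop
  | loop (a : ℝ) (ha : LoopNumber I T.toTrace a) : SingleNumber T a
  | total (k : ℕ) (hk : k ≤ T.len) : SingleNumber T (totalWeight I (T.U k))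
  | subtree (k : ℕ) (hk : k ≤ T.len) (i : Fin n) :
      SingleNumber T (totalWeight I (rule k (T.U k) i))

/-- The completion time of the job at position `j` in the list schedule that processes the jobs
nonpreemptively, without idle time, in the order `σ`. -/
def listCompletion (σ : Equiv.Perm (Fin n)) (j : Fin n) : ℝ :=
  ∑ k ∈ Finset.univ.filter (fun k => k ≤ j), (I.p (σ k) : ℝ)

end SingleMachine

end PrecSched

end

/-!
All bounds come from one observation about the virtual schedule. If the rates of an iteration are
`R i = z i / N` with natural numbers `z i` and `N`, and the job `j` is completed, then
`R i * τ j = (z i / z j) * (p j - Y j)`: the denominator `N` cancels, and a common denominator of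
the clock and of all `Y i` only gets multiplied by `z j`. As each of the at most `n` iterations
completes a job, numerators and denominators of at most `G` bits lead to a common denominator of at
most `L + G * n` bits (`Trace.RatesWithin.exists_denominator`). Together with `0 ≤ Y i ≤ p i` and
`τ i ≤ p i * N` this bounds all encoding lengths (`Trace.RatesWithin.loopNumber`). The wrap-around
rule only adds and subtracts numbers with this denominator, and since no rate exceeds `1`, a job is
split at most once in each interval, so that it takes at most two iterations (`WrapInv`).

It remains to bound the rates. For a single machine, `R i = W(i) / W` with sums of weights. For
parallel machines, a finite cut with `B` on the source side is given by a successor-closed set `X`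
of unfinished jobs and has the capacity `|F \ X| + w(X) / π`. Hence `{A}` is a minimum cut if and
only if `π * (m - |F \ X|) ≤ w(X)` for all such `X`, and the price is the smallest of the quotients
`w(X) / (m - |F \ X|)` with positive denominator (`IsPrice.exists_eq_cutPrice`), a fraction `α / ρ`
of `O(L)` bits. The integrality of the flow provides rates with the denominator `α * D`.

For the existence part, these quotients are positive when every job reaches a job of positive
weight, so the price exists. An integral maximum flow is obtained from Hall's theorem: in units of
`1 / (α * D)` all capacities are integers, the units starting at the available jobs are matched with
units of capacity at reachable jobs, with dummies for those that stay behind, and Hall's condition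
is the inequality above (`IsPrice.exists_integral_flow`). This flow has value `m > 0`, so some rate
is positive. For a single machine, a positive rate comes from the first available job that reaches a
given job of positive weight, or from the fact that every job lies in its own subtree of the search
forest.
-/

namespace PrecSched

/-! ### Numbers with a given denominator -/

/-- The additive group of the fractions `z / Q` with integers `z`, as real numbers. -/
def grid (Q : ℕ) : AddSubgroup ℝ where
  carrier := {a | ∃ z : ℤ, a * Q = z}
  zero_mem' := ⟨0, by simp⟩
  add_mem' := by
    rintro a b ⟨x, hx⟩ ⟨y, hy⟩
    exact ⟨x + y, by push_cast; rw [add_mul, hx, hy]⟩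
  neg_mem' := by
    rintro a ⟨x, hx⟩
    exact ⟨-x, by push_cast; rw [neg_mul, hx]⟩

theorem grid_mono {Q Q' : ℕ} (h : Q ∣ Q') {a : ℝ} (ha : a ∈ grid Q) : a ∈ grid Q' := by
  obtain ⟨c, rfl⟩ := h
  obtain ⟨z, hz⟩ := ha
  exact ⟨z * c, by push_cast; rw [← mul_assoc, hz]⟩

theorem natCast_mem_grid (Q a : ℕ) : (a : ℝ) ∈ grid Q := ⟨a * Q, by push_cast; rfl⟩

theorem one_mem_grid (Q : ℕ) : (1 : ℝ) ∈ grid Q := by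
  exact_mod_cast natCast_mem_grid Q 1

theorem ratCast_mem_grid (q : ℚ) : (q : ℝ) ∈ grid q.den :=
  ⟨q.num, by exact_mod_cast Rat.mul_den_eq_num q⟩

/-- A nonnegative number with denominator `Q` has a natural number as numerator. -/
theorem exists_nat_of_mem_grid {Q : ℕ} {a : ℝ} (h : a ∈ grid Q) (ha : 0 ≤ a) :
    ∃ z : ℕ, a * Q = z := by
  obtain ⟨z, hz⟩ := h
  have h0 : (0 : ℝ) ≤ z := hz ▸ by positivity
  obtain ⟨k, rfl⟩ := Int.eq_ofNat_of_zero_le (show 0 ≤ z by exact_mod_cast h0)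
  exact ⟨k, by simpa using hz⟩

/-- If `s` and `r` have the same denominator, it cancels in `s * (a / r)`: only the denominator of
`a` and the numerator `z` of `r` remain. -/
theorem mul_div_mem_grid {Q N z : ℕ} {a r s : ℝ} (ha : a ∈ grid Q) (hs : s ∈ grid N)
    (hr : r * N = z) (hr0 : r ≠ 0) : s * (a / r) ∈ grid (Q * z) := by
  obtain ⟨x, hx⟩ := ha
  obtain ⟨y, hy⟩ := hs
  refine ⟨x * y, ?_⟩
  push_cast
  rw [← hx, ← hy, ← hr]
  field_simp

theorem EncodedWithin.mono {b c : ℕ} (h : b ≤ c) {a : ℝ} (ha : EncodedWithin b a) :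
    EncodedWithin c a := by
  obtain ⟨q, hq, hl⟩ := ha
  exact ⟨q, hq, hl.trans h⟩

theorem encodedWithin_of_mem_grid {Q b c : ℕ} {a : ℝ} (hQ0 : 0 < Q) (hQ : Q ≤ 2 ^ b)
    (ha : |a| ≤ 2 ^ c) (h : a ∈ grid Q) : EncodedWithin (2 * b + c + 3) a := by
  obtain ⟨z, hz⟩ := h
  have hQ' : (Q : ℝ) ≠ 0 := by positivity
  set q : ℚ := Rat.divInt z (Q : ℤ) with hq
  have hqa : (q : ℝ) = a := by
    rw [hq, Rat.divInt_eq_div]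
    push_cast
    rw [← hz]
    field_simp
  have hden : q.den ≤ Q := by
    have := Rat.den_dvd z (Q : ℤ)
    exact Nat.le_of_dvd hQ0 (by exact_mod_cast this)
  have hnum : q.num.natAbs ≤ 2 ^ (b + c) := by
    have h1 : (q.num : ℝ) = a * q.den := by
      rw [← hqa]; exact_mod_cast (Rat.mul_den_eq_num q).symm
    have h2 : |(q.num : ℝ)| ≤ 2 ^ (b + c) := by
      rw [h1, abs_mul, Nat.abs_cast, pow_add, mul_comm]
      have : (q.den : ℝ) ≤ 2 ^ b := by exact_mod_cast hden.trans hQ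
      gcongr
    have h3 : ((q.num.natAbs : ℕ) : ℝ) ≤ 2 ^ (b + c) := by
      rw [Nat.cast_natAbs]; exact_mod_cast h2
    exact_mod_cast h3
  refine ⟨q, hqa, ?_⟩
  have h1 : Nat.size q.num.natAbs ≤ b + c + 1 :=
    Nat.size_le.2 (hnum.trans_lt (Nat.pow_lt_pow_right (by norm_num) (by omega)))
  have h2 : Nat.size q.den ≤ b + 1 :=
    Nat.size_le.2 ((hden.trans hQ).trans_lt (Nat.pow_lt_pow_right (by norm_num) (by omega)))
  unfold ratLen
  omega

/-! ### Size of the data of an instance -/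

section Size

variable {n : ℕ} (I : Inst n)

/-- The product of the denominators of the processing times. -/
def procDen : ℕ := ∏ j, (I.p j).den

theorem card_le_encLen : n ≤ I.encLen := by
  unfold Inst.encLen; omega

theorem two_pow_size_le (a : ℕ) : a ≤ 2 ^ Nat.size a := (Nat.lt_size_self a).le

theorem size_m_le : Nat.size I.m ≤ I.encLen := by
  unfold Inst.encLen; omega

theorem sum_ratLen_le : ∑ j, (ratLen (I.p j) + ratLen (I.w j)) ≤ I.encLen := by
  unfold Inst.encLen; omega

theorem m_le : I.m ≤ 2 ^ I.encLen :=
  (two_pow_size_le _).trans (Nat.pow_le_pow_right (by norm_num) (size_m_le I))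

theorem card_le_two_pow : n ≤ 2 ^ I.encLen :=
  (card_le_encLen I).trans Nat.lt_two_pow_self.le

theorem prod_den_le {f : Fin n → ℚ} (hf : ∀ j, ratLen (f j) ≤ ratLen (I.p j) + ratLen (I.w j)) :
    ∏ j, (f j).den ≤ 2 ^ I.encLen := by
  calc ∏ j, (f j).den ≤ ∏ j, 2 ^ ratLen (f j) := by
        refine Finset.prod_le_prod' fun j _ => (two_pow_size_le _).trans ?_
        refine Nat.pow_le_pow_right (by norm_num) ?_
        unfold ratLen; omega
    _ = 2 ^ ∑ j, ratLen (f j) := Finset.prod_pow_eq_pow_sum _ _ _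
    _ ≤ 2 ^ I.encLen := Nat.pow_le_pow_right (by norm_num)
        ((Finset.sum_le_sum fun j _ => hf j).trans (sum_ratLen_le I))

theorem weightDen_le : weightDen I ≤ 2 ^ I.encLen := prod_den_le I fun _ => Nat.le_add_left _ _

theorem procDen_le : procDen I ≤ 2 ^ I.encLen := prod_den_le I fun _ => Nat.le_add_right _ _

theorem weightDen_pos : 0 < weightDen I := Finset.prod_pos fun j _ => (I.w j).den_pos

theorem procDen_pos : 0 < procDen I := Finset.prod_pos fun j _ => (I.p j).den_pos

theorem w_mem_grid (j : Fin n) : (I.w j : ℝ) ∈ grid (weightDen I) :=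
  grid_mono (Finset.dvd_prod_of_mem (fun j => (I.w j).den) (Finset.mem_univ j))
    (ratCast_mem_grid _)

theorem p_mem_grid (j : Fin n) : (I.p j : ℝ) ∈ grid (procDen I) :=
  grid_mono (Finset.dvd_prod_of_mem (fun j => (I.p j).den) (Finset.mem_univ j))
    (ratCast_mem_grid _)

theorem totalWeight_mem_grid (J : Finset (Fin n)) : totalWeight I J ∈ grid (weightDen I) :=
  sum_mem fun j _ => w_mem_grid I j

theorem ratCast_le {q : ℚ} {b : ℕ} (hq : ratLen q ≤ b) : (q : ℝ) ≤ 2 ^ b := by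
  have h1 : (q : ℝ) ≤ (q.num.natAbs : ℝ) := by
    have : q ≤ (q.num.natAbs : ℚ) := by
      calc q ≤ |q| := le_abs_self q
        _ ≤ |q| * q.den := le_mul_of_one_le_right (abs_nonneg q) (by exact_mod_cast q.den_pos)
        _ = |(q.num : ℚ)| := by rw [← Rat.mul_den_eq_num q, abs_mul, Nat.abs_cast]
        _ = q.num.natAbs := by rw [Nat.cast_natAbs, Int.cast_abs]
    exact_mod_cast this
  refine h1.trans ?_
  exact_mod_cast (two_pow_size_le _).trans (Nat.pow_le_pow_right (by norm_num)
    (by unfold ratLen at hq; omega))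

theorem ratLen_le (j : Fin n) : ratLen (I.p j) + ratLen (I.w j) ≤ I.encLen :=
  (Finset.single_le_sum (f := fun j => ratLen (I.p j) + ratLen (I.w j))
    (fun _ _ => Nat.zero_le _) (Finset.mem_univ j)).trans (sum_ratLen_le I)

theorem w_le (j : Fin n) : (I.w j : ℝ) ≤ 2 ^ I.encLen :=
  ratCast_le (le_trans (Nat.le_add_left _ _) (ratLen_le I j))

theorem p_le (j : Fin n) : (I.p j : ℝ) ≤ 2 ^ I.encLen :=
  ratCast_le (le_trans (Nat.le_add_right _ _) (ratLen_le I j))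

theorem totalWeight_nonneg (J : Finset (Fin n)) : 0 ≤ totalWeight I J :=
  Finset.sum_nonneg fun j _ => by exact_mod_cast I.w_nonneg j

theorem sum_le_two_pow {f : Fin n → ℝ} {b : ℕ} (hf : ∀ j, f j ≤ 2 ^ b) (J : Finset (Fin n)) :
    ∑ j ∈ J, f j ≤ 2 ^ (I.encLen + b) := by
  calc ∑ j ∈ J, f j ≤ J.card • (2 ^ b : ℝ) := Finset.sum_le_card_nsmul _ _ _ fun j _ => hf j
    _ = (J.card : ℝ) * 2 ^ b := nsmul_eq_mul _ _
    _ ≤ 2 ^ I.encLen * 2 ^ b := by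
        have h : J.card ≤ 2 ^ I.encLen :=
          (by simpa using Finset.card_le_univ J : J.card ≤ n).trans (card_le_two_pow I)
        have : (J.card : ℝ) ≤ 2 ^ I.encLen := by exact_mod_cast h
        gcongr
    _ = 2 ^ (I.encLen + b) := (pow_add _ _ _).symm

theorem totalWeight_le (J : Finset (Fin n)) : totalWeight I J ≤ 2 ^ (2 * I.encLen) := by
  rw [two_mul]; exact sum_le_two_pow I (w_le I) J

end Size

/-! ### The virtual schedule for arbitrary rates -/

section Loop

variable {n : ℕ} {I : Inst n} {T : Trace n}

theorem mem_of_mem_avail {U : Finset (Fin n)} {i : Fin n} (h : i ∈ I.avail U) : i ∈ U :=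
  (Finset.mem_filter.1 h).1

theorem ObeysLoop.card_add (h : ObeysLoop I T) : ∀ k ≤ T.len, (T.U k).card + k = n := by
  intro k
  induction k with
  | zero => intro _; simp [h.U_zero]
  | succ k ih =>
    intro hk
    have h1 := h.U_succ ⟨k, hk⟩
    have h2 := mem_of_mem_avail (h.job_mem ⟨k, hk⟩)
    have h3 := Finset.card_erase_add_one h2
    simp only at h1 h2 h3
    rw [h1]
    have := ih (by omega)
    omega

theorem ObeysLoop.len_le (h : ObeysLoop I T) : T.len ≤ n := by
  have := h.card_add T.len le_rfl
  omega

theorem ObeysLoop.len_eq (h : ObeysLoop I T) (hc : T.Complete) : T.len = n := by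
  have := h.card_add T.len le_rfl
  rw [show T.U T.len = ∅ from hc] at this
  simpa using this

/-- The rates of all available jobs are nonnegative. -/
def Trace.NonnegRates (I : Inst n) (T : Trace n) : Prop :=
  ∀ k < T.len, ∀ i ∈ I.avail (T.U k), 0 ≤ T.R k i

theorem ObeysLoop.Y_bounds (h : ObeysLoop I T) (hR : T.NonnegRates I) :
    ∀ k ≤ T.len, ∀ i, 0 ≤ T.Y k i ∧ T.Y k i ≤ I.p i := by
  intro k
  induction k with
  | zero => intro _ i; rw [h.Y_zero]; exact ⟨le_rfl, by exact_mod_cast I.p_nonneg i⟩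
  | succ k ih =>
    intro hk i
    have ih := ih (by omega)
    by_cases hi : i ∈ I.avail (T.U k)
    · have h1 := h.Y_avail ⟨k, hk⟩ i hi
      have hj := h.rate_pos ⟨k, hk⟩
      have hm := h.job_min ⟨k, hk⟩ i hi
      simp only at h1 hj hm
      have ht : 0 ≤ T.tau I k (T.job ⟨k, hk⟩) :=
        div_nonneg (sub_nonneg.2 (ih _).2) hj.le
      have h0 := hR k hk i hi
      rw [h1]
      refine ⟨add_nonneg (ih i).1 (mul_nonneg h0 ht), ?_⟩
      rcases h0.eq_or_lt with h0 | h0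
      · rw [← h0, zero_mul, add_zero]; exact (ih i).2
      · have h2 := mul_le_mul_of_nonneg_left (hm h0) h0.le
        have h3 : T.R k i * T.tau I k i = I.p i - T.Y k i := by
          unfold Trace.tau; field_simp
        linarith
    · rw [show T.Y (k + 1) i = T.Y k i from h.Y_other ⟨k, hk⟩ i hi]
      exact ih i

theorem ObeysLoop.tau_nonneg (h : ObeysLoop I T) (hR : T.NonnegRates I) {k : ℕ} (hk : k < T.len)
    {i : Fin n} (hi : i ∈ I.avail (T.U k)) : 0 ≤ T.tau I k i :=
  div_nonneg (sub_nonneg.2 (h.Y_bounds hR k hk.le i).2) (hR k hk i hi)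

theorem ObeysLoop.t_le_succ (h : ObeysLoop I T) (hR : T.NonnegRates I) {k : ℕ} (hk : k < T.len) :
    T.t k ≤ T.t (k + 1) := by
  rw [show T.t (k + 1) = _ from h.t_succ ⟨k, hk⟩]
  have := h.tau_nonneg hR hk (h.job_mem ⟨k, hk⟩)
  simpa using this

theorem ObeysLoop.t_mono (h : ObeysLoop I T) (hR : T.NonnegRates I) {a b : ℕ} (hab : a ≤ b)
    (hb : b ≤ T.len) : T.t a ≤ T.t b := by
  induction b, hab using Nat.le_induction with
  | base => exact le_rfl
  | succ b hab ih => exact (ih (by omega)).trans (h.t_le_succ hR hb)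

theorem ObeysLoop.t_nonneg (h : ObeysLoop I T) (hR : T.NonnegRates I) {k : ℕ} (hk : k ≤ T.len) :
    0 ≤ T.t k := h.t_zero ▸ h.t_mono hR (Nat.zero_le k) hk

/-- In every iteration, the available jobs have nonnegative rates with a common denominator `N`
such that both `N` and all the numerators are at most `2 ^ G`. -/
def Trace.RatesWithin (I : Inst n) (T : Trace n) (G : ℕ) : Prop :=
  ∀ k < T.len, ∃ N : ℕ, 0 < N ∧ N ≤ 2 ^ G ∧
    ∀ i ∈ I.avail (T.U k), 0 ≤ T.R k i ∧ T.R k i ∈ grid N ∧ T.R k i * N ≤ 2 ^ G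

theorem Trace.RatesWithin.nonneg {G : ℕ} (hG : T.RatesWithin I G) : T.NonnegRates I := by
  intro k hk i hi
  obtain ⟨N, -, -, h⟩ := hG k hk
  exact (h i hi).1

theorem Trace.RatesWithin.exists_num {G : ℕ} (hG : T.RatesWithin I G) {k : ℕ} (hk : k < T.len) :
    ∃ N : ℕ, 0 < N ∧ N ≤ 2 ^ G ∧ ∀ i ∈ I.avail (T.U k), T.R k i ∈ grid N ∧
      ∃ z : ℕ, T.R k i * N = z ∧ z ≤ 2 ^ G := by
  obtain ⟨N, h0, h1, h⟩ := hG k hk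
  refine ⟨N, h0, h1, fun i hi => ⟨(h i hi).2.1, ?_⟩⟩
  obtain ⟨z, hz⟩ := exists_nat_of_mem_grid (h i hi).2.1 (h i hi).1
  refine ⟨z, hz, ?_⟩
  have := (h i hi).2.2
  rw [hz] at this
  exact_mod_cast this

theorem Trace.RatesWithin.tau_le {G : ℕ} (hG : T.RatesWithin I G) (h : ObeysLoop I T) {k : ℕ}
    (hk : k < T.len) {i : Fin n} (hi : i ∈ I.avail (T.U k)) (hR : 0 < T.R k i) :
    T.tau I k i ≤ 2 ^ (I.encLen + G) := by
  obtain ⟨N, hN0, hN, hz⟩ := hG.exists_num hk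
  obtain ⟨-, z, hz, -⟩ := hz i hi
  have hN0' : (0 : ℝ) < N := by exact_mod_cast hN0
  have hN' : (N : ℝ) ≤ 2 ^ G := by exact_mod_cast hN
  have hz1 : (1 : ℝ) ≤ z := by
    have : (0 : ℝ) < z := hz ▸ mul_pos hR hN0'
    exact_mod_cast this
  unfold Trace.tau
  rw [div_le_iff₀ hR]
  have h1 := (h.Y_bounds hG.nonneg k hk.le i).1
  have h2 := p_le I i
  have h3 : 1 ≤ 2 ^ G * T.R k i := by
    rw [← hz] at hz1; nlinarith
  calc (I.p i : ℝ) - T.Y k i ≤ 2 ^ I.encLen * 1 := by linarith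
    _ ≤ 2 ^ I.encLen * (2 ^ G * T.R k i) := by gcongr
    _ = 2 ^ (I.encLen + G) * T.R k i := by rw [pow_add]; ring

theorem Trace.RatesWithin.t_le {G : ℕ} (hG : T.RatesWithin I G) (h : ObeysLoop I T) {k : ℕ}
    (hk : k ≤ T.len) : T.t k ≤ 2 ^ (2 * I.encLen + G) := by
  have key : ∀ k ≤ T.len, T.t k ≤ k * 2 ^ (I.encLen + G) := by
    intro k
    induction k with
    | zero => intro _; simp [h.t_zero]
    | succ k ih =>
      intro hk
      rw [show T.t (k + 1) = _ from h.t_succ ⟨k, hk⟩]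
      have h1 := hG.tau_le h hk (h.job_mem ⟨k, hk⟩) (h.rate_pos ⟨k, hk⟩)
      have h2 := ih (by omega)
      push_cast
      linarith
  refine (key k hk).trans ?_
  have : (k : ℝ) ≤ 2 ^ I.encLen := by
    exact_mod_cast (hk.trans h.len_le).trans (card_le_two_pow I)
  calc (k : ℝ) * 2 ^ (I.encLen + G) ≤ 2 ^ I.encLen * 2 ^ (I.encLen + G) := by gcongr
    _ = _ := by rw [← pow_add]; congr 1; ring

/-- Each iteration multiplies a common denominator of all numbers found so far by the numerator of
the rate of the job that it completes, because
`R i * τ j = R i / R j * (p j - Y j)`, where the denominators of the rates cancel. -/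
theorem Trace.RatesWithin.exists_denominator {G : ℕ} (hG : T.RatesWithin I G)
    (h : ObeysLoop I T) {k : ℕ} (hk : k ≤ T.len) :
    ∃ Q : ℕ, 0 < Q ∧ Q ≤ 2 ^ (I.encLen + G * k) ∧ procDen I ∣ Q ∧
      ∀ l ≤ k, T.t l ∈ grid Q ∧ ∀ i, T.Y l i ∈ grid Q := by
  induction k with
  | zero =>
    refine ⟨procDen I, procDen_pos I, by simpa using procDen_le I, dvd_rfl, ?_⟩
    intro l hl
    obtain rfl : l = 0 := by omega
    exact ⟨h.t_zero ▸ zero_mem _, fun i => h.Y_zero i ▸ zero_mem _⟩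
  | succ k ih =>
    obtain ⟨Q, hQ0, hQ, hd, hl⟩ := ih (by omega)
    obtain ⟨N, hN0, -, hnum⟩ := hG.exists_num hk
    have hj := h.job_mem ⟨k, hk⟩
    have hRj := h.rate_pos ⟨k, hk⟩
    set j := T.job ⟨k, hk⟩ with hjdef
    simp only at hj hRj
    obtain ⟨-, z, hz, hzG⟩ := hnum j hj
    have hz0 : 0 < z := by
      have : (0 : ℝ) < z := hz ▸ mul_pos hRj (by exact_mod_cast hN0)
      exact_mod_cast this
    have hrem : (I.p j : ℝ) - T.Y k j ∈ grid Q :=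
      sub_mem (grid_mono hd (p_mem_grid I j)) ((hl k le_rfl).2 j)
    have hdvd : Q ∣ Q * z := Dvd.intro _ rfl
    refine ⟨Q * z, Nat.mul_pos hQ0 hz0, ?_, hd.trans hdvd, ?_⟩
    · calc Q * z ≤ 2 ^ (I.encLen + G * k) * 2 ^ G := Nat.mul_le_mul hQ hzG
        _ = _ := by rw [← pow_add]; congr 1; ring
    · intro l hlk
      rcases Nat.lt_or_ge l (k + 1) with hlt | hge
      · exact ⟨grid_mono hdvd (hl l (by omega)).1, fun i => grid_mono hdvd ((hl l (by omega)).2 i)⟩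
      · obtain rfl : l = k + 1 := by omega
        constructor
        · rw [show T.t (k + 1) = _ from h.t_succ ⟨k, hk⟩]
          refine add_mem (grid_mono hdvd (hl k le_rfl).1) ?_
          have := mul_div_mem_grid hrem (one_mem_grid N) hz hRj.ne'
          rwa [one_mul] at this
        · intro i
          by_cases hi : i ∈ I.avail (T.U k)
          · rw [show T.Y (k + 1) i = _ from h.Y_avail ⟨k, hk⟩ i hi]
            exact add_mem (grid_mono hdvd ((hl k le_rfl).2 i))
              (mul_div_mem_grid hrem (hnum i hi).1 hz hRj.ne')
          · rw [show T.Y (k + 1) i = T.Y k i from h.Y_other ⟨k, hk⟩ i hi]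
            exact grid_mono hdvd ((hl k le_rfl).2 i)

theorem Trace.RatesWithin.loopNumber {G : ℕ} (hG : T.RatesWithin I G) (h : ObeysLoop I T) {a : ℝ}
    (ha : LoopNumber I T a) :
    EncodedWithin (2 * (I.encLen + G * n) + (2 * I.encLen + G) + 3) a := by
  have hlen := h.len_le
  have hpow {b : ℕ} (hb : b ≤ 2 * I.encLen + G) : (2 : ℝ) ^ b ≤ 2 ^ (2 * I.encLen + G) :=
    pow_le_pow_right₀ (by norm_num) hb
  have hp (i : Fin n) : (I.p i : ℝ) ≤ 2 ^ (2 * I.encLen + G) :=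
    (p_le I i).trans (hpow (by omega))
  have hY := h.Y_bounds hG.nonneg
  have hQn {k Q : ℕ} (hk : k ≤ T.len) (hQ : Q ≤ 2 ^ (I.encLen + G * k)) :
      Q ≤ 2 ^ (I.encLen + G * n) := by
    refine hQ.trans (Nat.pow_le_pow_right (by norm_num) ?_)
    have := Nat.mul_le_mul_left G (hk.trans hlen)
    omega
  have clock : ∀ k ≤ T.len,
      EncodedWithin (2 * (I.encLen + G * n) + (2 * I.encLen + G) + 3) (T.t k) := by
    intro k hk
    obtain ⟨Q, hQ0, hQ, -, hl⟩ := hG.exists_denominator h hk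
    refine encodedWithin_of_mem_grid hQ0 (hQn hk hQ) ?_ (hl k le_rfl).1
    rw [abs_of_nonneg (h.t_nonneg hG.nonneg hk)]
    exact hG.t_le h hk
  cases ha with
  | clock k hk => exact clock k hk
  | elapsed k hk i =>
    obtain ⟨Q, hQ0, hQ, -, hl⟩ := hG.exists_denominator h hk
    refine encodedWithin_of_mem_grid hQ0 (hQn hk hQ) ?_ ((hl k le_rfl).2 i)
    rw [abs_of_nonneg (hY k hk i).1]
    exact (hY k hk i).2.trans (hp i)
  | rate k hk i hi =>
    obtain ⟨N, hN0, hN, hi'⟩ := hG k hk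
    obtain ⟨h0, h1, h2⟩ := hi' i hi
    refine encodedWithin_of_mem_grid hN0 (hN.trans (Nat.pow_le_pow_right (by norm_num) ?_)) ?_ h1
    · have := Nat.mul_le_mul_left G (show 1 ≤ n by omega)
      omega
    · rw [abs_of_nonneg h0]
      have : (1 : ℝ) ≤ N := by exact_mod_cast hN0
      exact (le_mul_of_one_le_right h0 this).trans (h2.trans (hpow (by omega)))
  | remaining k hk i hi =>
    obtain ⟨Q, hQ0, hQ, hd, hl⟩ := hG.exists_denominator h hk.le
    refine encodedWithin_of_mem_grid hQ0 (hQn hk.le hQ) ?_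
      (sub_mem (grid_mono hd (p_mem_grid I i)) ((hl k le_rfl).2 i))
    have h1 := hY k hk.le i
    rw [abs_of_nonneg (by linarith)]
    linarith [hp i]
  | tau k hk i hi hR =>
    obtain ⟨Q, hQ0, hQ, hd, hl⟩ := hG.exists_denominator h hk.le
    obtain ⟨N, hN0, -, hnum⟩ := hG.exists_num hk
    obtain ⟨-, z, hz, hzG⟩ := hnum i hi
    have hz0 : 0 < z := by
      have : (0 : ℝ) < z := hz ▸ mul_pos hR (by exact_mod_cast hN0)
      exact_mod_cast this
    have hmem := mul_div_mem_grid
      (sub_mem (grid_mono hd (p_mem_grid I i)) ((hl k le_rfl).2 i)) (one_mem_grid N) hz hR.ne'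
    rw [one_mul] at hmem
    refine encodedWithin_of_mem_grid (Nat.mul_pos hQ0 hz0) ?_ ?_ hmem
    · refine hQn (k := k + 1) hk ?_
      calc Q * z ≤ 2 ^ (I.encLen + G * k) * 2 ^ G := Nat.mul_le_mul hQ hzG
        _ = _ := by rw [← pow_add]; congr 1; ring
    · have h0 := h.tau_nonneg hG.nonneg hk hi
      have h1 := hG.tau_le h hk hi hR
      change |T.tau I k i| ≤ _
      rw [abs_of_nonneg h0]
      exact h1.trans (hpow (by omega))
  | increment k i hi =>
    obtain ⟨Q, hQ0, hQ, -, hl⟩ := hG.exists_denominator h k.2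
    have h1 : T.R k i * T.tau I k (T.job k) = T.Y (k + 1) i - T.Y k i := by
      rw [h.Y_avail k i hi]; ring
    rw [h1]
    refine encodedWithin_of_mem_grid hQ0 (hQn k.2 hQ) ?_
      (sub_mem ((hl _ le_rfl).2 i) ((hl k (by omega)).2 i))
    have h2 := hY k k.2.le i
    have h3 := hY (k + 1) k.2 i
    have h4 := hp i
    rw [abs_le]
    constructor <;> linarith
  | completion k => rw [h.C_job k]; exact clock _ k.2

end Loop

/-! ### Cuts and prices in the parametric network -/

section Cuts

variable {n : ℕ} {I : Inst n} {U : Finset (Fin n)}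

/-- The precedence arcs between jobs of `U`. -/
def precOn (I : Inst n) (U : Finset (Fin n)) : Finset (Fin n × Fin n) :=
  I.prec.filter fun e => e.1 ∈ U ∧ e.2 ∈ U

theorem sum_arcs {M : Type*} [AddCommMonoid M] (f : Node n × Node n → M) :
    ∑ a ∈ arcs I U, f a = ∑ e ∈ precOn I U, f (Node.job e.1, Node.job e.2) + f (Node.A, Node.B) +
      ∑ j ∈ I.avail U, f (Node.B, Node.job j) + ∑ j ∈ U, f (Node.job j, Node.Z) := by
  unfold arcs
  rw [Finset.sum_union, Finset.sum_union, Finset.sum_union, Finset.sum_singleton,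
    Finset.sum_image, Finset.sum_image, Finset.sum_image]
  · rfl
  · intro a _ b _ hab; simpa using hab
  · intro a _ b _ hab; simpa using hab
  · rintro ⟨a, b⟩ _ ⟨c, d⟩ _ hab; simpa using hab
  all_goals
    rw [Finset.disjoint_left]
    intro a ha hb
    simp only [Finset.mem_union, Finset.mem_image, Finset.mem_singleton] at ha hb
    aesop

theorem mem_arcs {a : Node n × Node n} : a ∈ arcs I U ↔
    (∃ e ∈ precOn I U, (Node.job e.1, Node.job e.2) = a) ∨ a = (Node.A, Node.B) ∨
      (∃ j ∈ I.avail U, (Node.B, Node.job j) = a) ∨ ∃ j ∈ U, (Node.job j, Node.Z) = a := by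
  unfold arcs precOn
  simp only [Finset.mem_union, Finset.mem_image, Finset.mem_singleton, or_assoc]

/-- `X` is a subset of `U` that contains all successors in `U` of its elements. -/
def SuccClosed (I : Inst n) (U X : Finset (Fin n)) : Prop :=
  X ⊆ U ∧ ∀ j ∈ X, ∀ k ∈ U, (j, k) ∈ I.prec → k ∈ X

theorem succClosed_self : SuccClosed I U U := ⟨subset_rfl, fun _ _ _ hk _ => hk⟩

theorem cutCapacity_of_succClosed {q : ℝ} (hq : 0 < q) {S : Finset (Node n)} (hA : Node.A ∈ S)
    (hB : Node.B ∈ S) (hZ : Node.Z ∉ S) {X : Finset (Fin n)} (hX : SuccClosed I U X)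
    (hS : ∀ j ∈ U, Node.job j ∈ S ↔ j ∈ X) :
    cutCapacity I U q S = ((I.avail U \ X).card : ℝ≥0∞) + ENNReal.ofReal (totalWeight I X / q) := by
  unfold cutCapacity
  rw [Finset.sum_filter, sum_arcs]
  simp only [hA, hB, hZ, capacity, not_true_eq_false, and_false, if_false, true_and,
    not_false_eq_true, and_true, add_zero]
  have h1 : ∑ e ∈ precOn I U,
      (if Node.job e.1 ∈ S ∧ Node.job e.2 ∉ S then (⊤ : ℝ≥0∞) else 0) = 0 := by
    refine Finset.sum_eq_zero fun e he => if_neg ?_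
    obtain ⟨he, h1, h2⟩ := Finset.mem_filter.1 he
    rw [hS _ h1, hS _ h2]
    exact fun h => h.2 (hX.2 _ h.1 _ h2 he)
  have h2 : ∑ j ∈ I.avail U, (if Node.job j ∉ S then (1 : ℝ≥0∞) else 0) =
      ((I.avail U \ X).card : ℝ≥0∞) := by
    rw [← Finset.sum_filter, Finset.sum_const, nsmul_eq_mul, mul_one]
    congr 2
    ext j
    simp only [Finset.mem_filter, Finset.mem_sdiff]
    exact and_congr_right fun h => not_congr (hS j (mem_of_mem_avail h))
  have h3 : ∑ j ∈ U, (if Node.job j ∈ S then ENNReal.ofReal ((I.w j : ℝ) / q) else 0) =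
      ENNReal.ofReal (totalWeight I X / q) := by
    rw [← Finset.sum_filter, totalWeight, Finset.sum_div, ENNReal.ofReal_sum_of_nonneg]
    · refine Finset.sum_congr ?_ fun _ _ => rfl
      ext j
      simp only [Finset.mem_filter]
      exact ⟨fun h => (hS j h.1).1 h.2, fun h => ⟨hX.1 h, (hS j (hX.1 h)).2 h⟩⟩
    · intro j _
      have : (0 : ℝ) ≤ I.w j := by exact_mod_cast I.w_nonneg j
      positivity
  rw [h1, h2, h3, zero_add]

theorem cutCapacity_singleton (q : ℝ) : cutCapacity I U q {Node.A} = I.m := by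
  unfold cutCapacity
  rw [Finset.sum_filter, sum_arcs]
  simp [capacity]

theorem natCast_le_natCast_add_ofReal {m c : ℕ} {x : ℝ} (hx : 0 ≤ x) :
    (m : ℝ≥0∞) ≤ (c : ℝ≥0∞) + ENNReal.ofReal x ↔ (m : ℝ) ≤ c + x := by
  rw [← ENNReal.ofReal_natCast m, ← ENNReal.ofReal_natCast c,
    ← ENNReal.ofReal_add (Nat.cast_nonneg c) hx, ENNReal.ofReal_le_ofReal_iff (by positivity)]

/-- A cut of finite capacity that has `B` on its source side is given by the successor-closed set
`X` of jobs on that side, and cuts with `B` on the sink side have capacity at least `m`. -/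
theorem isMinCut_singleton_iff {q : ℝ} (hq : 0 < q) :
    IsMinCut I U q {Node.A} ↔ ∀ X, SuccClosed I U X →
      q * ((I.m : ℝ) - (I.avail U \ X).card) ≤ totalWeight I X := by
  have key (X : Finset (Fin n)) : (I.m : ℝ) ≤ (I.avail U \ X).card + totalWeight I X / q ↔
      q * ((I.m : ℝ) - (I.avail U \ X).card) ≤ totalWeight I X := by
    rw [← sub_le_iff_le_add', le_div_iff₀' hq]
  have hnn (X : Finset (Fin n)) : 0 ≤ totalWeight I X / q :=
    div_nonneg (totalWeight_nonneg I X) hq.le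
  constructor
  · rintro ⟨-, h⟩ X hX
    have h1 := h (X.image Node.job ∪ {Node.A, Node.B}) ?_ (by simp) (by simp)
    · rw [cutCapacity_singleton, cutCapacity_of_succClosed hq (X := X) (by simp) (by simp)
        (by simp) hX (by simp), natCast_le_natCast_add_ofReal (hnn X)] at h1
      exact (key X).1 h1
    · intro v hv
      simp only [Finset.mem_union, Finset.mem_image, Finset.mem_insert, Finset.mem_singleton,
        nodes] at hv ⊢
      rcases hv with ⟨j, hj, rfl⟩ | hv | hv
      · exact Or.inl ⟨j, hX.1 hj, rfl⟩
      · exact Or.inr (Or.inl hv)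
      · exact Or.inr (Or.inr (Or.inl hv))
  · intro h
    refine ⟨⟨by simp [nodes], by simp, by simp⟩, fun S hS hA hZ => ?_⟩
    rw [cutCapacity_singleton]
    by_cases hB : Node.B ∈ S
    · by_cases hc : ∃ e ∈ precOn I U, Node.job e.1 ∈ S ∧ Node.job e.2 ∉ S
      · obtain ⟨e, he, h1, h2⟩ := hc
        have : cutCapacity I U q S = ⊤ := by
          unfold cutCapacity
          rw [ENNReal.sum_eq_top]
          exact ⟨(Node.job e.1, Node.job e.2),
            Finset.mem_filter.2 ⟨mem_arcs.2 (Or.inl ⟨e, he, rfl⟩), h1, h2⟩, rfl⟩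
        rw [this]
        exact le_top
      · push Not at hc
        have hX : SuccClosed I U (U.filter fun j => Node.job j ∈ S) := by
          refine ⟨Finset.filter_subset _ _, fun j hj k hk hjk => ?_⟩
          obtain ⟨hj, hjS⟩ := Finset.mem_filter.1 hj
          exact Finset.mem_filter.2
            ⟨hk, hc (j, k) (Finset.mem_filter.2 ⟨hjk, hj, hk⟩) hjS⟩
        rw [cutCapacity_of_succClosed hq hA hB hZ hX (fun j hj => by simp [hj]),
          natCast_le_natCast_add_ofReal (hnn _)]
        exact (key _).2 (h _ hX)
    · have h1 : (Node.A, Node.B) ∈ (arcs I U).filter fun a => a.1 ∈ S ∧ a.2 ∉ S :=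
        Finset.mem_filter.2 ⟨mem_arcs.2 (Or.inr (Or.inl rfl)), hA, hB⟩
      exact Finset.single_le_sum (f := capacity I q) (fun _ _ => zero_le) h1

open Classical in
/-- The successor-closed sets whose cuts restrict the price. -/
noncomputable def tightSets (I : Inst n) (U : Finset (Fin n)) : Finset (Finset (Fin n)) :=
  U.powerset.filter fun X => SuccClosed I U X ∧ (I.avail U \ X).card < I.m

theorem mem_tightSets {X : Finset (Fin n)} :
    X ∈ tightSets I U ↔ SuccClosed I U X ∧ (I.avail U \ X).card < I.m := by
  classical
  unfold tightSets
  rw [Finset.mem_filter, Finset.mem_powerset]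
  exact and_iff_right_of_imp fun h => h.1.1

theorem tightSets_nonempty : (tightSets I U).Nonempty := by
  refine ⟨U, mem_tightSets.2 ⟨succClosed_self, ?_⟩⟩
  rw [Finset.sdiff_eq_empty_iff_subset.2 fun i hi => mem_of_mem_avail hi]
  exact I.m_pos

/-- The largest parameter for which the cut given by `X` has capacity at least `m`. -/
noncomputable def cutPrice (I : Inst n) (U X : Finset (Fin n)) : ℝ :=
  totalWeight I X / ((I.m : ℝ) - (I.avail U \ X).card)

theorem isMinCut_singleton_iff_le_cutPrice {q : ℝ} (hq : 0 < q) :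
    IsMinCut I U q {Node.A} ↔ ∀ X ∈ tightSets I U, q ≤ cutPrice I U X := by
  rw [isMinCut_singleton_iff hq]
  constructor
  · intro h X hX
    obtain ⟨hX, hm⟩ := mem_tightSets.1 hX
    have : (0 : ℝ) < (I.m : ℝ) - (I.avail U \ X).card := sub_pos.2 (by exact_mod_cast hm)
    exact (le_div_iff₀ this).2 (h X hX)
  · intro h X hX
    rcases lt_or_ge (I.avail U \ X).card I.m with hm | hm
    · have : (0 : ℝ) < (I.m : ℝ) - (I.avail U \ X).card := sub_pos.2 (by exact_mod_cast hm)
      exact (le_div_iff₀ this).1 (h X (mem_tightSets.2 ⟨hX, hm⟩))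
    · refine le_trans (mul_nonpos_of_nonneg_of_nonpos hq.le ?_) (totalWeight_nonneg I X)
      exact sub_nonpos.2 (by exact_mod_cast hm)

theorem exists_isPrice (h : ∀ X ∈ tightSets I U, 0 < totalWeight I X) :
    ∃ q, IsPrice I U q := by
  obtain ⟨X, hX, hmin⟩ := Finset.exists_min_image _ (cutPrice I U)
    (tightSets_nonempty (I := I) (U := U))
  have h0 : 0 < cutPrice I U X :=
    div_pos (h X hX) (sub_pos.2 (by exact_mod_cast (mem_tightSets.1 hX).2))
  exact ⟨cutPrice I U X, ⟨h0, (isMinCut_singleton_iff_le_cutPrice h0).2 hmin⟩,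
    fun q hq => (isMinCut_singleton_iff_le_cutPrice hq.1).1 hq.2 X hX⟩

theorem IsPrice.exists_eq_cutPrice {q : ℝ} (h : IsPrice I U q) :
    ∃ X ∈ tightSets I U, q = cutPrice I U X := by
  obtain ⟨X, hX, hmin⟩ := Finset.exists_min_image _ (cutPrice I U)
    (tightSets_nonempty (I := I) (U := U))
  have h1 := (isMinCut_singleton_iff_le_cutPrice h.1.1).1 h.1.2 X hX
  have h0 : 0 < cutPrice I U X := h.1.1.trans_le h1
  exact ⟨X, hX, h1.antisymm (h.2 ⟨h0, (isMinCut_singleton_iff_le_cutPrice h0).2 hmin⟩)⟩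

/-- A price is a fraction of small natural numbers. The numerator `α` is the weight of a set
of jobs, made integral by the common denominator of the weights; the denominator `ρ` contains this
common denominator as a factor, so that all the numbers `w j * ρ` are integers. -/
theorem IsPrice.exists_fraction {q : ℝ} (h : IsPrice I U q) :
    ∃ α ρ : ℕ, 0 < α ∧ 0 < ρ ∧ q = (α : ℝ) / ρ ∧ α ≤ 2 ^ (3 * I.encLen) ∧
      ρ ≤ 2 ^ (2 * I.encLen) ∧ weightDen I ∣ ρ := by
  obtain ⟨X, hX, hq⟩ := h.exists_eq_cutPrice
  obtain ⟨-, hm⟩ := mem_tightSets.1 hX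
  have hD := weightDen_pos I
  have hD' : (0 : ℝ) < weightDen I := by exact_mod_cast hD
  have hDle : (weightDen I : ℝ) ≤ 2 ^ I.encLen := by exact_mod_cast weightDen_le I
  obtain ⟨α, hα⟩ := exists_nat_of_mem_grid (totalWeight_mem_grid I X) (totalWeight_nonneg I X)
  have hsub : ((I.m - (I.avail U \ X).card : ℕ) : ℝ) = (I.m : ℝ) - (I.avail U \ X).card :=
    Nat.cast_sub hm.le
  have hc : 0 < I.m - (I.avail U \ X).card := by omega
  have hc' : (0 : ℝ) < (I.m : ℝ) - (I.avail U \ X).card := by rw [← hsub]; exact_mod_cast hc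
  have hq' : q = (α : ℝ) / ((I.m - (I.avail U \ X).card) * weightDen I : ℕ) := by
    rw [hq, ← hα, cutPrice]
    push_cast
    rw [hsub]
    field_simp
  refine ⟨α, (I.m - (I.avail U \ X).card) * weightDen I, ?_, Nat.mul_pos hc hD, hq', ?_, ?_,
    Dvd.intro_left _ rfl⟩
  · rcases Nat.eq_zero_or_pos α with h0 | h0
    · have := h.1.1
      rw [hq', h0] at this
      simp at this
    · exact h0
  · have : (α : ℝ) ≤ 2 ^ (3 * I.encLen) := by
      rw [← hα]
      calc totalWeight I X * weightDen I ≤ 2 ^ (2 * I.encLen) * 2 ^ I.encLen := by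
            gcongr
            exact totalWeight_le I X
        _ = _ := by rw [← pow_add]; congr 1; ring
    exact_mod_cast this
  · calc (I.m - (I.avail U \ X).card) * weightDen I ≤ 2 ^ I.encLen * 2 ^ I.encLen :=
          Nat.mul_le_mul ((Nat.sub_le _ _).trans (m_le I)) (weightDen_le I)
      _ = _ := by rw [← pow_add]; congr 1; ring

end Cuts

/-! ### Encoding length of flows and of the virtual schedule on parallel machines -/

section Flows

variable {n : ℕ} {I : Inst n} {U : Finset (Fin n)} {q : ℝ} {x : Node n × Node n → ℝ}

theorem IsFlow.ab_le (hx : IsFlow I U q x) : x (Node.A, Node.B) ≤ I.m := by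
  have h := hx.le_capacity _ (mem_arcs.2 (Or.inr (Or.inl rfl)))
  change ENNReal.ofReal _ ≤ (I.m : ℝ≥0∞) at h
  rwa [← ENNReal.ofReal_natCast, ENNReal.ofReal_le_ofReal_iff (Nat.cast_nonneg _)] at h

theorem IsFlow.b_job_le (hx : IsFlow I U q x) {j : Fin n} (hj : j ∈ I.avail U) :
    x (Node.B, Node.job j) ≤ 1 := by
  have h := hx.le_capacity _ (mem_arcs.2 (Or.inr (Or.inr (Or.inl ⟨j, hj, rfl⟩))))
  change ENNReal.ofReal _ ≤ (1 : ℝ≥0∞) at h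
  rwa [← ENNReal.ofReal_one, ENNReal.ofReal_le_ofReal_iff zero_le_one] at h

theorem IsFlow.job_z_le (hx : IsFlow I U q x) (hq : 0 < q) {j : Fin n} (hj : j ∈ U) :
    x (Node.job j, Node.Z) ≤ I.w j / q := by
  have h := hx.le_capacity _ (mem_arcs.2 (Or.inr (Or.inr (Or.inr ⟨j, hj, rfl⟩))))
  change ENNReal.ofReal _ ≤ ENNReal.ofReal _ at h
  have h0 : (0 : ℝ) ≤ I.w j := by exact_mod_cast I.w_nonneg j
  rwa [ENNReal.ofReal_le_ofReal_iff (by positivity)] at h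

theorem sum_arcs_into_job (f : Node n × Node n → ℝ) {v : Fin n} :
    ∑ a ∈ (arcs I U).filter (fun a => a.2 = Node.job v), f a =
      ∑ e ∈ (precOn I U).filter (fun e => e.2 = v), f (Node.job e.1, Node.job e.2) +
        if v ∈ I.avail U then f (Node.B, Node.job v) else 0 := by
  rw [Finset.sum_filter, sum_arcs, Finset.sum_filter]
  simp

theorem sum_arcs_out_of_job (f : Node n × Node n → ℝ) {v : Fin n} (hv : v ∈ U) :
    ∑ a ∈ (arcs I U).filter (fun a => a.1 = Node.job v), f a =
      ∑ e ∈ (precOn I U).filter (fun e => e.1 = v), f (Node.job e.1, Node.job e.2) +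
        f (Node.job v, Node.Z) := by
  rw [Finset.sum_filter, sum_arcs, Finset.sum_filter]
  simp [hv]

/-- The uncapacitated arcs carry a bounded flow as well: all flow through an arc to `k` leaves
through the arcs from the successors of `k` to `Z`. As the graph is acyclic, the tail of the arc is
not one of these successors. -/
theorem IsFlow.job_job_le (hx : IsFlow I U q x) (hq : 0 < q) {e : Fin n × Fin n}
    (he : e ∈ precOn I U) :
    ∃ X ⊆ U, x (Node.job e.1, Node.job e.2) ≤ totalWeight I X / q := by
  classical
  obtain ⟨hep, he1, he2⟩ := Finset.mem_filter.1 he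
  set X := U.filter fun l => I.Reaches e.2 l with hX
  have hXU : X ⊆ U := Finset.filter_subset _ _
  have hnot : e.1 ∉ X := fun h => I.acyclic e.1
    (Relation.TransGen.head' (show (e.1, e.2) ∈ I.prec from hep) (Finset.mem_filter.1 h).2)
  have hmem : e.2 ∈ X := Finset.mem_filter.2 ⟨he2, Relation.ReflTransGen.refl⟩
  have hclosed : ∀ a ∈ precOn I U, a.1 ∈ X → a.2 ∈ X := by
    intro a ha h1
    obtain ⟨hap, -, ha2⟩ := Finset.mem_filter.1 ha
    exact Finset.mem_filter.2 ⟨ha2, (Finset.mem_filter.1 h1).2.tail hap⟩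
  set g : Fin n × Fin n → ℝ := fun e => x (Node.job e.1, Node.job e.2) with hg
  have hg0 : ∀ a ∈ precOn I U, 0 ≤ g a := fun a ha =>
    hx.nonneg _ (mem_arcs.2 (Or.inl ⟨a, ha, rfl⟩))
  have hcons : ∀ v ∈ X, ∑ a ∈ (precOn I U).filter (fun a => a.2 = v), g a ≤
      ∑ a ∈ (precOn I U).filter (fun a => a.1 = v), g a + I.w v / q := by
    intro v hv
    have h1 := hx.conservation (Node.job v)
      (by simp only [nodes, Finset.mem_union, Finset.mem_image]; exact Or.inl ⟨v, hXU hv, rfl⟩)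
      (by simp) (by simp)
    rw [sum_arcs_into_job, sum_arcs_out_of_job _ (hXU hv)] at h1
    have h2 := hx.job_z_le hq (hXU hv)
    have h3 : 0 ≤ if v ∈ I.avail U then x (Node.B, Node.job v) else 0 := by
      split_ifs with h
      · exact hx.nonneg _ (mem_arcs.2 (Or.inr (Or.inr (Or.inl ⟨v, h, rfl⟩))))
      · exact le_rfl
    linarith
  have hsum := Finset.sum_le_sum hcons
  rw [Finset.sum_add_distrib, ← Finset.sum_div, Finset.sum_fiberwise_eq_sum_filter,
    Finset.sum_fiberwise_eq_sum_filter] at hsum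
  refine ⟨X, hXU, ?_⟩
  have hsplit : g e + ∑ a ∈ (precOn I U).filter (fun a => a.1 ∈ X), g a ≤
      ∑ a ∈ (precOn I U).filter (fun a => a.2 ∈ X), g a := by
    rw [← Finset.sum_insert (by simp [hnot])]
    refine Finset.sum_le_sum_of_subset_of_nonneg ?_ fun a ha _ => hg0 a (Finset.mem_filter.1 ha).1
    intro a ha
    rcases Finset.mem_insert.1 ha with rfl | ha
    · exact Finset.mem_filter.2 ⟨he, hmem⟩
    · obtain ⟨h1, h2⟩ := Finset.mem_filter.1 ha
      exact Finset.mem_filter.2 ⟨h1, hclosed a h1 h2⟩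
  unfold totalWeight
  linarith

theorem IsPrice.totalWeight_div_le (hq : IsPrice I U q) (X : Finset (Fin n)) :
    totalWeight I X / q ≤ 2 ^ (4 * I.encLen) := by
  obtain ⟨α, ρ, hα, hρ, rfl, -, hρ', -⟩ := hq.exists_fraction
  have hα' : (1 : ℝ) ≤ α := by exact_mod_cast hα
  have hρ'' : (ρ : ℝ) ≤ 2 ^ (2 * I.encLen) := by exact_mod_cast hρ'
  have h0 := totalWeight_nonneg I X
  have h1 := totalWeight_le I X
  calc totalWeight I X / (α / ρ) = totalWeight I X * ρ / α := by field_simp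
    _ ≤ totalWeight I X * ρ := div_le_self (by positivity) hα'
    _ ≤ 2 ^ (2 * I.encLen) * 2 ^ (2 * I.encLen) := by gcongr
    _ = _ := by rw [← pow_add]; congr 1; ring

theorem IsPrice.w_div_le (hq : IsPrice I U q) (j : Fin n) :
    (I.w j : ℝ) / q ≤ 2 ^ (4 * I.encLen) := by
  simpa [totalWeight] using hq.totalWeight_div_le {j}

theorem IsFlow.le_two_pow (hx : IsFlow I U q x) (hq : IsPrice I U q) {a : Node n × Node n}
    (ha : a ∈ arcs I U) : x a ≤ 2 ^ (4 * I.encLen) := by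
  have h1 : (1 : ℝ) ≤ 2 ^ (4 * I.encLen) := one_le_pow₀ (by norm_num)
  rcases mem_arcs.1 ha with ⟨e, he, rfl⟩ | rfl | ⟨j, hj, rfl⟩ | ⟨j, hj, rfl⟩
  · obtain ⟨X, -, hX⟩ := hx.job_job_le hq.1.1 he
    exact hX.trans (hq.totalWeight_div_le X)
  · refine hx.ab_le.trans ?_
    have : (I.m : ℝ) ≤ 2 ^ I.encLen := by exact_mod_cast m_le I
    exact this.trans (pow_le_pow_right₀ (by norm_num) (by omega))
  · exact (hx.b_job_le hj).trans h1
  · exact (hx.job_z_le hq.1.1 hj).trans (hq.w_div_le j)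

/-- The flows of an integral maximum flow have a small common denominator. -/
theorem IsPrice.exists_flow_denominator (hq : IsPrice I U q) :
    ∃ N : ℕ, 0 < N ∧ N ≤ 2 ^ (4 * I.encLen) ∧
      ∀ x, IsIntegralFlow I U q x → ∀ a ∈ arcs I U, x a ∈ grid N := by
  obtain ⟨α, ρ, hα, hρ, hqe, hα', -, -⟩ := hq.exists_fraction
  refine ⟨α * weightDen I, Nat.mul_pos hα (weightDen_pos I), ?_, fun x hx a ha => ?_⟩
  · calc α * weightDen I ≤ 2 ^ (3 * I.encLen) * 2 ^ I.encLen :=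
          Nat.mul_le_mul hα' (weightDen_le I)
      _ = _ := by rw [← pow_add]; congr 1; ring
  · obtain ⟨z, hz⟩ := hx α ρ hρ hqe a ha
    exact ⟨z, by push_cast; exact hz⟩

end Flows

section Parallel

variable {n : ℕ} {I : Inst n}

theorem ParallelRun.rate_bounds (T : ParallelRun I) {k : ℕ} (hk : k < T.len) {i : Fin n}
    (hi : i ∈ I.avail (T.U k)) : 0 ≤ T.R k i ∧ T.R k i ≤ 1 := by
  rcases Nat.lt_or_ge I.m (I.avail (T.U k)).card with hm | hm
  · rw [T.rate_many k hk hm i hi]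
    have hf := (T.flow_max k hk hm).1
    exact ⟨hf.nonneg _ (mem_arcs.2 (Or.inr (Or.inr (Or.inl ⟨i, hi, rfl⟩)))), hf.b_job_le hi⟩
  · rw [T.rate_few k hk hm i hi]
    exact ⟨zero_le_one, le_rfl⟩

theorem ParallelRun.ratesWithin (T : ParallelRun I) :
    T.toTrace.RatesWithin I (4 * I.encLen) := by
  intro k hk
  suffices h : ∃ N : ℕ, 0 < N ∧ N ≤ 2 ^ (4 * I.encLen) ∧
      ∀ i ∈ I.avail (T.U k), T.R k i ∈ grid N by
    obtain ⟨N, hN0, hN, h⟩ := h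
    refine ⟨N, hN0, hN, fun i hi => ⟨(T.rate_bounds hk hi).1, h i hi, ?_⟩⟩
    have hN' : (N : ℝ) ≤ 2 ^ (4 * I.encLen) := by exact_mod_cast hN
    exact (mul_le_of_le_one_left (Nat.cast_nonneg _) (T.rate_bounds hk hi).2).trans hN'
  rcases Nat.lt_or_ge I.m (I.avail (T.U k)).card with hm | hm
  · obtain ⟨N, hN0, hN, h⟩ := (T.price_spec k hk hm).exists_flow_denominator
    refine ⟨N, hN0, hN, fun i hi => ?_⟩
    rw [T.rate_many k hk hm i hi]
    exact h _ (T.flow_integral k hk hm) _ (mem_arcs.2 (Or.inr (Or.inr (Or.inl ⟨i, hi, rfl⟩))))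
  · refine ⟨1, one_pos, Nat.one_le_two_pow, fun i hi => ?_⟩
    rw [T.rate_few k hk hm i hi]
    exact one_mem_grid 1

/-- A bound for the encoding length of all numbers of an instance of encoding length `L`. -/
def lenBound (L : ℕ) : ℕ := 40 * (L * L) + 40 * L + 40

theorem LoopNumber.encodedWithin {T : Trace n} (hG : T.RatesWithin I (4 * I.encLen))
    (h : ObeysLoop I T) {a : ℝ} (ha : LoopNumber I T a) :
    EncodedWithin (lenBound I.encLen) a := by
  refine (hG.loopNumber h ha).mono ?_
  have : 4 * I.encLen * n ≤ 4 * (I.encLen * I.encLen) := by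
    rw [mul_assoc]
    exact Nat.mul_le_mul_left 4 (Nat.mul_le_mul_left _ (card_le_encLen I))
  unfold lenBound
  omega

theorem encodedWithin_natCast {a b : ℕ} (h : a ≤ 2 ^ b) : EncodedWithin (b + 3) (a : ℝ) := by
  have := encodedWithin_of_mem_grid (Q := 1) (b := 0) (c := b) one_pos le_rfl
    (a := a) (by rw [Nat.abs_cast]; exact_mod_cast h) (natCast_mem_grid 1 a)
  simpa using this

theorem IsPrice.encodedWithin {U : Finset (Fin n)} {q : ℝ} (hq : IsPrice I U q) :
    EncodedWithin (lenBound I.encLen) q := by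
  obtain ⟨α, ρ, hα, hρ, rfl, hα', hρ', -⟩ := hq.exists_fraction
  have hρ1 : (1 : ℝ) ≤ ρ := by exact_mod_cast hρ
  have hα1 : (α : ℝ) ≤ 2 ^ (3 * I.encLen) := by exact_mod_cast hα'
  refine (encodedWithin_of_mem_grid (b := 2 * I.encLen) (c := 3 * I.encLen) hρ hρ' ?_
    (a := (α : ℝ) / ρ) ⟨α, by push_cast; field_simp⟩).mono (by unfold lenBound; omega)
  rw [abs_of_nonneg (by positivity)]
  exact (div_le_self (by positivity) hρ1).trans hα1

theorem IsPrice.encodedWithin_w_div {U : Finset (Fin n)} {q : ℝ} (hq : IsPrice I U q)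
    (j : Fin n) : EncodedWithin (lenBound I.encLen) ((I.w j : ℝ) / q) := by
  have hle := hq.w_div_le j
  have hq0 := hq.1.1
  have hw0 : (0 : ℝ) ≤ I.w j := by exact_mod_cast I.w_nonneg j
  obtain ⟨α, ρ, hα, hρ, hqe, hα', -, hd⟩ := hq.exists_fraction
  have hmem : (I.w j : ℝ) / q ∈ grid α := by
    obtain ⟨z, hz⟩ := grid_mono hd (w_mem_grid I j)
    refine ⟨z, ?_⟩
    rw [← hz, hqe]
    field_simp
  refine (encodedWithin_of_mem_grid (b := 3 * I.encLen) (c := 4 * I.encLen) hα hα' ?_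
    hmem).mono (by unfold lenBound; omega)
  rwa [abs_of_nonneg (by positivity)]

theorem ParallelNumber.encodedWithin {T : ParallelRun I} {a : ℝ} (ha : ParallelNumber T a) :
    EncodedWithin (lenBound I.encLen) a := by
  have hone : EncodedWithin (lenBound I.encLen) 1 := by
    have := encodedWithin_natCast (a := 1) (b := 0) le_rfl
    rw [Nat.cast_one] at this
    exact this.mono (by unfold lenBound; omega)
  cases ha with
  | loop a ha => exact ha.encodedWithin T.ratesWithin T.obeys
  | price k hk h => exact (T.price_spec k hk h).encodedWithin
  | capacity k hk h a ha hfin =>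
    have hq := T.price_spec k hk h
    rcases mem_arcs.1 ha with ⟨e, he, rfl⟩ | rfl | ⟨j, hj, rfl⟩ | ⟨j, hj, rfl⟩
    · exact absurd rfl hfin
    · change EncodedWithin _ ((I.m : ℝ≥0∞)).toReal
      rw [ENNReal.toReal_natCast]
      exact (encodedWithin_natCast (m_le I)).mono (by unfold lenBound; omega)
    · change EncodedWithin _ ((1 : ℝ≥0∞)).toReal
      rwa [ENNReal.toReal_one]
    · change EncodedWithin _ (ENNReal.ofReal ((I.w j : ℝ) / T.price k)).toReal
      have hw0 : (0 : ℝ) ≤ I.w j := by exact_mod_cast I.w_nonneg j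
      rw [ENNReal.toReal_ofReal (div_nonneg hw0 hq.1.1.le)]
      exact hq.encodedWithin_w_div j
  | flow k hk h a ha =>
    have hq := T.price_spec k hk h
    have hf := (T.flow_max k hk h).1
    obtain ⟨N, hN0, hN, hx⟩ := hq.exists_flow_denominator
    refine (encodedWithin_of_mem_grid (c := 4 * I.encLen) hN0 hN ?_
      (hx _ (T.flow_integral k hk h) a ha)).mono (by unfold lenBound; omega)
    rw [abs_of_nonneg (hf.nonneg a ha)]
    exact hf.le_two_pow hq ha

end Parallel

/-! ### The wrap-around rule -/

section Wrap

variable {n : ℕ} {I : Inst n} {T : Trace n}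

theorem injective_of_erase {len : ℕ} {U : ℕ → Finset (Fin n)} {job : Fin len → Fin n}
    (hmem : ∀ k : Fin len, job k ∈ U k) (hU : ∀ k : Fin len, U (k + 1) = (U k).erase (job k)) :
    Function.Injective job := by
  have hsub : ∀ a b, a ≤ b → b ≤ len → U b ⊆ U a := by
    intro a b hab
    induction b, hab using Nat.le_induction with
    | base => exact fun _ => subset_rfl
    | succ b hab ih =>
      intro hb
      rw [show U (b + 1) = _ from hU ⟨b, hb⟩]
      exact (Finset.erase_subset _ _).trans (ih (by omega))
  have key : ∀ a b : Fin len, a < b → job a ≠ job b := by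
    intro a b hab heq
    have h1 := hsub (a + 1) b hab b.2.le (hmem b)
    rw [hU a, heq] at h1
    exact Finset.notMem_erase _ _ h1
  intro a b hab
  rcases lt_trichotomy a b with hlt | heq | hgt
  · exact absurd hab (key a b hlt)
  · exact heq
  · exact absurd hab.symm (key b a hgt)

theorem ObeysLoop.job_injective (h : ObeysLoop I T) : Function.Injective T.job :=
  injective_of_erase (fun k => mem_of_mem_avail (h.job_mem k)) h.U_succ

/-- Both `σ` and the order in which the loop completes the jobs sort the completion times. -/
theorem ObeysLoop.C_sorted (h : ObeysLoop I T) (hR : T.NonnegRates I) (hc : T.Complete)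
    {σ : Equiv.Perm (Fin n)} (hσ : Monotone (T.C ∘ σ)) (j : Fin n) :
    T.C (σ j) = T.t (j + 1) := by
  have hlen := h.len_eq hc
  have hinj : Function.Injective (fun j : Fin n => T.job (Fin.cast hlen.symm j)) :=
    h.job_injective.comp (Fin.cast_injective _)
  set e : Equiv.Perm (Fin n) := Equiv.ofBijective _ (Finite.injective_iff_bijective.1 hinj) with he
  have hCe (k : Fin n) : T.C (e k) = T.t (k + 1) := h.C_job (Fin.cast hlen.symm k)
  have hmono : Monotone (T.C ∘ e) := by
    intro a b hab
    simp only [Function.comp_apply, hCe]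
    exact h.t_mono hR (by have := Fin.le_def.1 hab; omega) (by omega)
  rw [← hCe j]
  exact congrFun (Tuple.unique_monotone hσ hmono) j

theorem ObeysLoop.intervalEnd_eq (h : ObeysLoop I T) (hR : T.NonnegRates I) (hc : T.Complete)
    {σ : Equiv.Perm (Fin n)} (hσ : Monotone (T.C ∘ σ)) (j : Fin n) :
    intervalEnd T σ j = T.t (j + 1) := h.C_sorted hR hc hσ j

theorem ObeysLoop.intervalStart_eq (h : ObeysLoop I T) (hR : T.NonnegRates I) (hc : T.Complete)
    {σ : Equiv.Perm (Fin n)} (hσ : Monotone (T.C ∘ σ)) (j : Fin n) :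
    intervalStart T σ j = T.t j := by
  unfold intervalStart
  split_ifs with h0
  · rw [h0, h.t_zero]
  · rw [h.C_sorted hR hc hσ]
    congr 1
    simp only
    omega

theorem ObeysLoop.amount_bounds (h : ObeysLoop I T)
    (hR : ∀ k < T.len, ∀ i ∈ I.avail (T.U k), 0 ≤ T.R k i ∧ T.R k i ≤ 1)
    {j : Fin n} (hj : (j : ℕ) < T.len) (i : Fin n) :
    0 ≤ amount T j i ∧ amount T j i ≤ T.t (j + 1) - T.t j := by
  have hnn : T.NonnegRates I := fun k hk i hi => (hR k hk i hi).1
  have ht : 0 ≤ T.tau I j (T.job ⟨j, hj⟩) := h.tau_nonneg hnn hj (h.job_mem ⟨j, hj⟩)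
  have ht' : T.t (j + 1) - T.t j = T.tau I j (T.job ⟨j, hj⟩) := by
    rw [show T.t (j + 1) = _ from h.t_succ ⟨j, hj⟩]; simp
  rw [ht']
  unfold amount
  by_cases hi : i ∈ I.avail (T.U j)
  · rw [show T.Y (j + 1) i = _ from h.Y_avail ⟨j, hj⟩ i hi]
    obtain ⟨h0, h1⟩ := hR j hj i hi
    simp only [add_sub_cancel_left]
    exact ⟨mul_nonneg h0 ht, mul_le_of_le_one_left ht h1⟩
  · rw [show T.Y (j + 1) i = T.Y j i from h.Y_other ⟨j, hj⟩ i hi, sub_self]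
    exact ⟨le_rfl, ht⟩

/-- What is known about the state `s` after `r` iterations of the wrap-around rule for the `j`-th
interval, if all numbers have denominator `Q`. By the last item every job takes at most two
iterations: if the current job has been split, its rest fits on the new machine. -/
structure WrapInv (T : Trace n) (σ : Equiv.Perm (Fin n)) (Q : ℕ) (j : Fin n) (r : ℕ)
    (s : WrapState) : Prop where
  start_le : intervalStart T σ j ≤ s.u
  le_end : s.u ≤ intervalEnd T σ j
  rest_nonneg : 0 ≤ s.Δ
  rest_le : s.Δ ≤ intervalEnd T σ j - intervalStart T σ j
  time_mem : s.u ∈ grid Q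
  rest_mem : s.Δ ∈ grid Q
  pos_le : s.k ≤ n
  machine_le : s.i ≤ 2 * n + 1
  progress : s.k < n → s.i ≤ r + 1 ∧
    (r + 2 * j ≤ 2 * s.k ∨ r + 2 * j ≤ 2 * s.k + 1 ∧ s.u + s.Δ ≤ intervalEnd T σ j)

theorem WrapInv.step {σ : Equiv.Perm (Fin n)} {Q : ℕ} {j : Fin n} {r : ℕ} {s : WrapState}
    (hamount : ∀ i, 0 ≤ amount T j i ∧
      amount T j i ≤ intervalEnd T σ j - intervalStart T σ j ∧ amount T j i ∈ grid Q)
    (hs : intervalStart T σ j ∈ grid Q) (he : intervalEnd T σ j ∈ grid Q)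
    (h : WrapInv T σ Q j r s) : WrapInv T σ Q j (r + 1) (wrapStep T σ j s) := by
  have hse : intervalStart T σ j ≤ intervalEnd T σ j := h.start_le.trans h.le_end
  have h1 := h.start_le
  have h2 := h.le_end
  have h3 := h.rest_nonneg
  have h4 := h.rest_le
  unfold wrapStep
  split_ifs with hk hu hk'
  · obtain ⟨hi, hp⟩ := h.progress hk
    obtain ⟨a1, a2, a3⟩ := hamount (σ ⟨s.k + 1, hk'⟩)
    exact
      { start_le := by simp only; linarith
        le_end := hu
        rest_nonneg := a1
        rest_le := a2
        time_mem := add_mem h.time_mem h.rest_mem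
        rest_mem := a3
        pos_le := hk
        machine_le := h.machine_le
        progress := fun _ => by
          simp only
          exact ⟨by omega, Or.inl (by omega)⟩ }
  · exact
      { start_le := by simp only; linarith
        le_end := hu
        rest_nonneg := h3
        rest_le := h4
        time_mem := add_mem h.time_mem h.rest_mem
        rest_mem := h.rest_mem
        pos_le := hk
        machine_le := h.machine_le
        progress := fun hlt => absurd hlt hk' }
  · obtain ⟨hi, hp⟩ := h.progress hk
    -- a job that has been split already fits, so the current job has not been split
    have hp' : r + 2 * j ≤ 2 * s.k := hp.resolve_right fun hp => hu hp.2
    push Not at hu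
    exact
      { start_le := le_rfl
        le_end := hse
        rest_nonneg := by simp only; linarith
        rest_le := by simp only; linarith
        time_mem := hs
        rest_mem := sub_mem (add_mem h.time_mem h.rest_mem) he
        pos_le := h.pos_le
        machine_le := by simp only; omega
        progress := fun _ => by
          simp only
          exact ⟨by omega, Or.inr ⟨by omega, by linarith⟩⟩ }
  · exact
      { start_le := h1
        le_end := h2
        rest_nonneg := h3
        rest_le := h4
        time_mem := h.time_mem
        rest_mem := h.rest_mem
        pos_le := h.pos_le
        machine_le := h.machine_le
        progress := fun hlt => absurd hlt hk }

theorem WrapInv.wrapState {σ : Equiv.Perm (Fin n)} {Q : ℕ} {j : Fin n}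
    (hamount : ∀ i, 0 ≤ amount T j i ∧
      amount T j i ≤ intervalEnd T σ j - intervalStart T σ j ∧ amount T j i ∈ grid Q)
    (hse : intervalStart T σ j ≤ intervalEnd T σ j)
    (hs : intervalStart T σ j ∈ grid Q) (he : intervalEnd T σ j ∈ grid Q) (r : ℕ) :
    WrapInv T σ Q j r (wrapState T σ j r) := by
  induction r with
  | zero =>
    obtain ⟨a1, a2, a3⟩ := hamount (σ j)
    exact
      { start_le := le_rfl
        le_end := hse
        rest_nonneg := a1
        rest_le := a2
        time_mem := hs
        rest_mem := a3
        pos_le := j.2.le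
        machine_le := by change 1 ≤ 2 * n + 1; omega
        progress := fun _ => by
          change 1 ≤ 0 + 1 ∧ (0 + 2 * (j : ℕ) ≤ 2 * (j : ℕ) ∨ _)
          exact ⟨by omega, Or.inl (by omega)⟩ }
  | succ r ih =>
    unfold PrecSched.wrapState at ih ⊢
    rw [Function.iterate_succ_apply']
    exact ih.step hamount hs he

theorem ParallelRun.exists_wrapInv (T : ParallelRun I) (hc : T.Complete)
    {σ : Equiv.Perm (Fin n)} (hσ : Monotone (T.C ∘ σ)) :
    ∃ Q : ℕ, 0 < Q ∧ Q ≤ 2 ^ (I.encLen + 4 * I.encLen * n) ∧ ∀ j,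
      (0 ≤ intervalStart T.toTrace σ j ∧ intervalStart T.toTrace σ j ∈ grid Q) ∧
      (0 ≤ intervalEnd T.toTrace σ j ∧ intervalEnd T.toTrace σ j ≤ 2 ^ (6 * I.encLen) ∧
        intervalEnd T.toTrace σ j ∈ grid Q) ∧
      ∀ r, WrapInv T.toTrace σ Q j r (wrapState T.toTrace σ j r) := by
  have hnn := T.ratesWithin.nonneg
  have hlen := T.obeys.len_eq hc
  obtain ⟨Q, hQ0, hQ, -, hl⟩ := T.ratesWithin.exists_denominator T.obeys le_rfl
  refine ⟨Q, hQ0, by rwa [hlen] at hQ, fun j => ?_⟩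
  have hj : (j : ℕ) < T.len := by rw [hlen]; exact j.2
  have h1 := T.obeys.intervalStart_eq hnn hc hσ j
  have h2 := T.obeys.intervalEnd_eq hnn hc hσ j
  have hs : intervalStart T.toTrace σ j ∈ grid Q := by
    rw [h1]; exact (hl j hj.le).1
  have he : intervalEnd T.toTrace σ j ∈ grid Q := by
    rw [h2]; exact (hl (j + 1) hj).1
  refine ⟨⟨by rw [h1]; exact T.obeys.t_nonneg hnn hj.le, hs⟩,
    ⟨by rw [h2]; exact T.obeys.t_nonneg hnn hj, ?_, he⟩, ?_⟩
  · rw [h2]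
    refine (T.ratesWithin.t_le T.obeys hj).trans_eq ?_
    congr 1
    ring
  · refine WrapInv.wrapState (fun i => ?_) ?_ hs he
    · have h3 := T.obeys.amount_bounds (fun k hk i hi => T.rate_bounds hk hi) hj i
      rw [h1, h2]
      exact ⟨h3.1, h3.2, sub_mem ((hl _ hj).2 i) ((hl _ hj.le).2 i)⟩
    · rw [h1, h2]
      exact T.obeys.t_le_succ hnn hj

theorem ParallelRun.wrap_terminates (T : ParallelRun I) (hc : T.Complete)
    {σ : Equiv.Perm (Fin n)} (hσ : Monotone (T.C ∘ σ)) (j : Fin n) :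
    n ≤ (wrapState T.toTrace σ j (2 * n)).k := by
  obtain ⟨Q, -, -, h⟩ := T.exists_wrapInv hc hσ
  by_contra! hlt
  have := (h j).2.2 (2 * n) |>.progress hlt
  omega

theorem WrapNumber.encodedWithin {T : ParallelRun I} (hc : T.Complete)
    {σ : Equiv.Perm (Fin n)} (hσ : Monotone (T.C ∘ σ)) {a : ℝ}
    (ha : WrapNumber T.toTrace σ a) : EncodedWithin (lenBound I.encLen) a := by
  obtain ⟨Q, hQ0, hQ, h⟩ := T.exists_wrapInv hc hσ
  have hnat {b : ℕ} (hb : b ≤ 2 * n + 1) : EncodedWithin (lenBound I.encLen) (b : ℝ) := by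
    refine (encodedWithin_natCast (b := I.encLen + 2) ?_).mono (by unfold lenBound; omega)
    have h1 := card_le_two_pow I
    have h2 := Nat.one_le_two_pow (n := I.encLen)
    rw [pow_add]
    omega
  have hreal {b : ℝ} (hb : b ∈ grid Q) (h0 : 0 ≤ b) (h1 : b ≤ 2 * 2 ^ (6 * I.encLen)) :
      EncodedWithin (lenBound I.encLen) b := by
    refine (encodedWithin_of_mem_grid (c := 6 * I.encLen + 1) hQ0 hQ ?_ hb).mono ?_
    · rw [abs_of_nonneg h0, pow_succ]
      linarith
    · have : 4 * I.encLen * n ≤ 4 * (I.encLen * I.encLen) := by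
        rw [mul_assoc]
        exact Nat.mul_le_mul_left 4 (Nat.mul_le_mul_left _ (card_le_encLen I))
      unfold lenBound
      omega
  have hpow : (0 : ℝ) < 2 ^ (6 * I.encLen) := by positivity
  cases ha with
  | left j =>
    obtain ⟨⟨s0, s1⟩, ⟨e0, e1, e2⟩, hw⟩ := h j
    have := (hw 0).start_le.trans (hw 0).le_end
    exact hreal s1 s0 (by linarith)
  | right j =>
    obtain ⟨-, ⟨e0, e1, e2⟩, hw⟩ := h j
    exact hreal e2 e0 (by linarith)
  | machine j r => exact hnat ((h j).2.2 r).machine_le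
  | position j r =>
    have := ((h j).2.2 r).pos_le
    exact hnat (by omega)
  | time j r =>
    obtain ⟨⟨s0, s1⟩, ⟨e0, e1, e2⟩, hw⟩ := h j
    have h1 := (hw r).start_le
    have h2 := (hw r).le_end
    exact hreal (hw r).time_mem (by linarith) (by linarith)
  | rest j r =>
    obtain ⟨⟨s0, s1⟩, ⟨e0, e1, e2⟩, hw⟩ := h j
    have h1 := (hw r).rest_le
    exact hreal (hw r).rest_mem (hw r).rest_nonneg (by linarith)
  | sum j r hr =>
    obtain ⟨⟨s0, s1⟩, ⟨e0, e1, e2⟩, hw⟩ := h j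
    have h1 := (hw r).start_le
    have h2 := (hw r).le_end
    have h3 := (hw r).rest_le
    have h4 := (hw r).rest_nonneg
    exact hreal (add_mem (hw r).time_mem (hw r).rest_mem) (by linarith) (by linarith)

end Wrap

/-! ### Existence of prices and of integral maximum flows -/

section Existence

variable {n : ℕ} {I : Inst n} {U : Finset (Fin n)} {q : ℝ}

theorem SuccClosed.trans {X : Finset (Fin n)} (hU : SuccClosed I Finset.univ U)
    (hX : SuccClosed I U X) : SuccClosed I Finset.univ X :=
  ⟨Finset.subset_univ _, fun j hj k hk hjk => hX.2 j hj k (hU.2 j (hX.1 hj) k hk hjk) hjk⟩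

theorem SuccClosed.mem_of_reaches (hU : SuccClosed I Finset.univ U) {i j : Fin n} (hi : i ∈ U)
    (h : I.Reaches i j) : j ∈ U := by
  induction h with
  | refl => exact hi
  | tail _ h ih => exact hU.2 _ ih _ (Finset.mem_univ _) h

theorem totalWeight_pos_of_mem {J : Finset (Fin n)} {j : Fin n} (hj : j ∈ J) (hw : 0 < I.w j) :
    0 < totalWeight I J :=
  Finset.sum_pos' (fun j _ => by exact_mod_cast I.w_nonneg j) ⟨j, hj, by exact_mod_cast hw⟩

theorem totalWeight_pos {X : Finset (Fin n)} (hX : SuccClosed I Finset.univ X)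
    (hne : X.Nonempty) (hw : ∀ j, ∃ k, I.Reaches j k ∧ 0 < I.w k) : 0 < totalWeight I X := by
  obtain ⟨j, hj⟩ := hne
  obtain ⟨k, hjk, hk⟩ := hw j
  exact totalWeight_pos_of_mem (hX.mem_of_reaches hj hjk) hk

theorem exists_isPrice_of_reaches (hw : ∀ j, ∃ k, I.Reaches j k ∧ 0 < I.w k)
    (hU : SuccClosed I Finset.univ U) (hm : I.m < (I.avail U).card) : ∃ q, IsPrice I U q := by
  refine exists_isPrice fun X hX => ?_
  obtain ⟨hX, hXm⟩ := mem_tightSets.1 hX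
  refine totalWeight_pos (hU.trans hX) ?_ hw
  rw [Finset.nonempty_iff_ne_empty]
  rintro rfl
  rw [Finset.sdiff_empty] at hXm
  omega

/-- A path from `i` to `l` as a unit of flow: `g` counts how often each arc is used. -/
theorem exists_path_flow (hU : SuccClosed I Finset.univ U) {i l : Fin n} (hi : i ∈ U)
    (h : I.Reaches i l) :
    ∃ g : Fin n × Fin n → ℕ, ∀ v,
      ∑ e ∈ (precOn I U).filter (fun e => e.2 = v), g e + (if i = v then 1 else 0) =
        ∑ e ∈ (precOn I U).filter (fun e => e.1 = v), g e + if l = v then 1 else 0 := by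
  induction h with
  | refl => exact ⟨0, fun v => by simp⟩
  | @tail b c hb hbc ih =>
    obtain ⟨g, hg⟩ := ih
    have hbU := hU.mem_of_reaches hi hb
    have hcU := hU.mem_of_reaches hi (hb.tail hbc)
    have hmem : (b, c) ∈ precOn I U := Finset.mem_filter.2 ⟨hbc, hbU, hcU⟩
    refine ⟨fun e => g e + if (b, c) = e then 1 else 0, fun v => ?_⟩
    rw [Finset.sum_add_distrib, Finset.sum_add_distrib, Finset.sum_ite_eq, Finset.sum_ite_eq]
    have := hg v
    simp only [Finset.mem_filter, hmem, true_and]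
    omega

/-- Hall's theorem in the form that is used for the units of flow: `c` units start at each node of
`F`, and `m * c` of them are sent, those from `i` to nodes in `r i`. The node `l` accepts at most
`b l` units. -/
theorem exists_unit_assignment {F : Finset (Fin n)} {c : ℕ} {b : Fin n → ℕ} {m : ℕ}
    (hm : m ≤ F.card) (r : Fin n → Finset (Fin n))
    (hall : ∀ F' ⊆ F, F'.Nonempty → F'.card * c ≤ ∑ l ∈ F'.biUnion r, b l + (F.card - m) * c) :
    ∃ (P : Finset (F × Fin c)) (dst : F × Fin c → Fin n), P.card = m * c ∧
      (∀ u ∈ P, dst u ∈ r u.1) ∧ ∀ l, (P.filter fun u => dst u = l).card ≤ b l := by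
  classical
  -- the elements of the second summand are dummies that absorb the units which are not sent
  set t : F × Fin c → Finset ((Σ _ : Fin n, ℕ) ⊕ ℕ) := fun u =>
    ((r u.1).sigma fun l => Finset.range (b l)).disjSum (Finset.range ((F.card - m) * c)) with ht
  have hHall : ∀ s : Finset (F × Fin c), s.card ≤ (s.biUnion t).card := by
    intro s
    rcases s.eq_empty_or_nonempty with rfl | ⟨u, hu⟩
    · simp
    set F' : Finset (Fin n) := s.image fun u => (u.1 : Fin n) with hF'
    have h1 : s.card ≤ F'.card * c := by
      have hsub : s.image (fun u => ((u.1 : Fin n), u.2)) ⊆ F' ×ˢ Finset.univ := by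
        intro p hp
        obtain ⟨v, hv, rfl⟩ := Finset.mem_image.1 hp
        exact Finset.mem_product.2 ⟨Finset.mem_image_of_mem _ hv, Finset.mem_univ _⟩
      have := Finset.card_le_card hsub
      rwa [Finset.card_image_of_injective, Finset.card_product, Finset.card_univ,
        Fintype.card_fin] at this
      intro a b h
      obtain ⟨h1, h2⟩ := Prod.mk.inj h
      exact Prod.ext (Subtype.ext h1) h2
    have h2 : ((F'.biUnion r).sigma fun l => Finset.range (b l)).disjSum
        (Finset.range ((F.card - m) * c)) ⊆ s.biUnion t := by
      intro y hy
      rw [Finset.mem_biUnion]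
      rcases y with p | d
      · rw [Finset.inl_mem_disjSum, Finset.mem_sigma, Finset.mem_biUnion] at hy
        obtain ⟨⟨i, hi, hpi⟩, hp⟩ := hy
        obtain ⟨v, hv, rfl⟩ := Finset.mem_image.1 hi
        exact ⟨v, hv, Finset.inl_mem_disjSum.2 (Finset.mem_sigma.2 ⟨hpi, hp⟩)⟩
      · exact ⟨u, hu, Finset.inr_mem_disjSum.2 (Finset.inr_mem_disjSum.1 hy)⟩
    have h3 := Finset.card_le_card h2
    rw [Finset.card_disjSum, Finset.card_sigma, Finset.card_range] at h3
    simp only [Finset.card_range] at h3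
    refine h1.trans ((hall F' ?_ ⟨_, Finset.mem_image_of_mem _ hu⟩).trans h3)
    intro i hi
    obtain ⟨v, -, rfl⟩ := Finset.mem_image.1 hi
    exact v.1.2
  obtain ⟨f, hf, hft⟩ := (Finset.all_card_le_biUnion_card_iff_exists_injective t).1 hHall
  set dst : F × Fin c → Fin n := fun u => Sum.elim (fun p => p.1) (fun _ => u.1) (f u) with hdst
  set S : Finset (F × Fin c) := Finset.univ.filter fun u => (f u).isLeft = true with hS
  have hcard : m * c ≤ S.card := by
    have h1 : (Finset.univ.filter fun u => ¬ (f u).isLeft = true).card ≤ (F.card - m) * c := by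
      refine (Finset.card_le_card_of_injOn f (t := (Finset.range ((F.card - m) * c)).image Sum.inr)
        (fun u hu => ?_) hf.injOn).trans (Finset.card_image_le.trans_eq (Finset.card_range _))
      have h2 := hft u
      have h3 := (Finset.mem_filter.1 (Finset.mem_coe.1 hu)).2
      rcases hfu : f u with p | d
      · simp [hfu] at h3
      · rw [hfu] at h2
        exact Finset.mem_coe.2 (Finset.mem_image_of_mem _ (Finset.inr_mem_disjSum.1 h2))
    have h2 := Finset.card_filter_add_card_filter_not (s := (Finset.univ : Finset (F × Fin c)))
      (fun u => (f u).isLeft = true)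
    rw [Finset.card_univ, Fintype.card_prod, Fintype.card_coe, Fintype.card_fin] at h2
    have h3 : (F.card - m) * c + m * c = F.card * c := by
      rw [← add_mul]; congr 1; omega
    rw [hS]
    omega
  obtain ⟨P, hPS, hP⟩ := Finset.exists_subset_card_eq hcard
  have hleft : ∀ u ∈ P, ∃ p : Σ _ : Fin n, ℕ, f u = Sum.inl p ∧ dst u = p.1 ∧ p.1 ∈ r u.1 ∧
      p.2 < b p.1 := by
    intro u hu
    have h1 := (Finset.mem_filter.1 (hPS hu)).2
    have h2 := hft u
    rcases hfu : f u with p | d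
    · rw [hfu] at h2
      obtain ⟨h3, h4⟩ := Finset.mem_sigma.1 (Finset.inl_mem_disjSum.1 h2)
      exact ⟨p, rfl, by rw [hdst]; simp [hfu], h3, Finset.mem_range.1 h4⟩
    · simp [hfu] at h1
  refine ⟨P, dst, hP, fun u hu => ?_, fun l => ?_⟩
  · obtain ⟨p, -, h1, h2, -⟩ := hleft u hu
    rwa [h1]
  · rw [← Finset.card_image_of_injective _ hf, ← Finset.card_range (b l),
      ← Finset.card_image_of_injective (Finset.range (b l))
        (f := fun d => (Sum.inl ⟨l, d⟩ : (Σ _ : Fin n, ℕ) ⊕ ℕ)) (by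
          intro x y hxy
          simpa using hxy)]
    refine Finset.card_le_card fun y hy => ?_
    obtain ⟨u, hu, rfl⟩ := Finset.mem_image.1 hy
    obtain ⟨hu, hul⟩ := Finset.mem_filter.1 hu
    obtain ⟨⟨p1, p2⟩, h1, h2, -, h4⟩ := hleft u hu
    obtain rfl : p1 = l := by rw [← hul, h2]
    rw [h1]
    exact Finset.mem_image_of_mem _ (Finset.mem_range.2 h4)

theorem flowValue_eq (x : Node n × Node n → ℝ) : flowValue I U x = x (Node.A, Node.B) := by
  unfold flowValue
  rw [Finset.sum_filter, sum_arcs]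
  simp

theorem sum_arcs_into_B (f : Node n × Node n → ℝ) :
    ∑ a ∈ (arcs I U).filter (fun a => a.2 = Node.B), f a = f (Node.A, Node.B) := by
  rw [Finset.sum_filter, sum_arcs]
  simp

theorem sum_arcs_out_of_B (f : Node n × Node n → ℝ) :
    ∑ a ∈ (arcs I U).filter (fun a => a.1 = Node.B), f a =
      ∑ j ∈ I.avail U, f (Node.B, Node.job j) := by
  rw [Finset.sum_filter, sum_arcs]
  simp

/-- The flow, in units of `1 / c`, that consists of the paths of all units in `P`: the unit `u`
travels from `u.1` along the path `g u` to `dst u`. -/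
noncomputable def unitFlow {F : Finset (Fin n)} {c : ℕ} (P : Finset (F × Fin c))
    (dst : F × Fin c → Fin n) (g : F × Fin c → Fin n × Fin n → ℕ) : Node n × Node n → ℕ
  | (Node.A, Node.B) => P.card
  | (Node.B, Node.job j) => (P.filter fun u => (u.1 : Fin n) = j).card
  | (Node.job j, Node.job k) => ∑ u ∈ P, g u (j, k)
  | (Node.job j, Node.Z) => (P.filter fun u => dst u = j).card
  | _ => 0

theorem isFlow_unitFlow {c : ℕ} (hc : 0 < c) {P : Finset (I.avail U × Fin c)}
    {dst : I.avail U × Fin c → Fin n} {g : I.avail U × Fin c → Fin n × Fin n → ℕ}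
    (hP : P.card ≤ I.m * c)
    (hdst : ∀ l, ((P.filter fun u => dst u = l).card : ℝ) ≤ I.w l / q * c)
    (hg : ∀ u ∈ P, ∀ v,
      ∑ e ∈ (precOn I U).filter (fun e => e.2 = v), g u e + (if (u.1 : Fin n) = v then 1 else 0) =
        ∑ e ∈ (precOn I U).filter (fun e => e.1 = v), g u e + if dst u = v then 1 else 0) :
    IsFlow I U q fun a => (unitFlow P dst g a : ℝ) / c := by
  have hc' : (0 : ℝ) < c := by exact_mod_cast hc
  refine ⟨fun a _ => by positivity, fun a ha => ?_, fun v hv hA hZ => ?_⟩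
  · rcases mem_arcs.1 ha with ⟨e, he, rfl⟩ | rfl | ⟨j, hj, rfl⟩ | ⟨j, hj, rfl⟩
    · exact le_top
    · change ENNReal.ofReal ((P.card : ℝ) / c) ≤ (I.m : ℝ≥0∞)
      rw [← ENNReal.ofReal_natCast, ENNReal.ofReal_le_ofReal_iff (Nat.cast_nonneg _),
        div_le_iff₀ hc']
      exact_mod_cast hP
    · change ENNReal.ofReal (((P.filter fun u => (u.1 : Fin n) = j).card : ℝ) / c) ≤ (1 : ℝ≥0∞)
      rw [← ENNReal.ofReal_one, ENNReal.ofReal_le_ofReal_iff zero_le_one, div_le_iff₀ hc', one_mul]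
      have h1 : (P.filter fun u => (u.1 : Fin n) = j).card ≤
          (Finset.univ : Finset (Fin c)).card := by
        refine Finset.card_le_card_of_injOn (fun u => u.2)
          (fun _ _ => Finset.mem_coe.2 (Finset.mem_univ _)) ?_
        intro u hu v hv huv
        have h2 := (Finset.mem_filter.1 (Finset.mem_coe.1 hu)).2
        have h3 := (Finset.mem_filter.1 (Finset.mem_coe.1 hv)).2
        exact Prod.ext (Subtype.ext (h2.trans h3.symm)) huv
      rw [Finset.card_univ, Fintype.card_fin] at h1
      exact_mod_cast h1
    · change ENNReal.ofReal (((P.filter fun u => dst u = j).card : ℝ) / c) ≤ ENNReal.ofReal _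
      exact ENNReal.ofReal_le_ofReal ((div_le_iff₀ hc').2 (hdst j))
  · rcases v with _ | _ | _ | v
    · exact absurd rfl hA
    · rw [sum_arcs_into_B, sum_arcs_out_of_B, ← Finset.sum_div, ← Nat.cast_sum]
      congr 2
      exact Finset.card_eq_sum_card_fiberwise (f := fun u : I.avail U × Fin c => (u.1 : Fin n))
        fun u _ => u.1.2
    · exact absurd rfl hZ
    · have hvU : v ∈ U := by simpa [nodes] using hv
      rw [sum_arcs_into_job, sum_arcs_out_of_job _ hvU, ← Finset.sum_div, ← Finset.sum_div]
      have h1 := Finset.sum_congr rfl fun u hu => hg u hu v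
      rw [Finset.sum_add_distrib, Finset.sum_add_distrib, Finset.sum_comm,
        Finset.sum_comm (s := P) (t := (precOn I U).filter fun e => e.1 = v),
        ← Finset.card_filter, ← Finset.card_filter] at h1
      have h2 : (if v ∈ I.avail U then
          (unitFlow P dst g (Node.B, Node.job v) : ℝ) / c else 0) =
          ((P.filter fun u => (u.1 : Fin n) = v).card : ℝ) / c := by
        split_ifs with h
        · rfl
        · rw [Finset.filter_eq_empty_iff.2 fun u _ (hu : (u.1 : Fin n) = v) => h (hu ▸ u.1.2)]
          simp
      rw [h2, ← add_div]
      change _ = _ + ((P.filter fun u => dst u = v).card : ℝ) / c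
      rw [← add_div]
      congr 1
      exact_mod_cast h1

/-- In units of `1 / (α * D)`, where `α` is the numerator of the price in lowest terms, all
capacities are integers, and Hall's condition is the minimality of the cut `{A}`. -/
theorem IsPrice.exists_integral_flow (hq : IsPrice I U q) (hU : SuccClosed I Finset.univ U)
    (hm : I.m < (I.avail U).card) :
    ∃ x, IsMaxFlow I U q x ∧ IsIntegralFlow I U q x ∧ flowValue I U x = I.m := by
  classical
  obtain ⟨α, ρ, hα, hρ, hqe, hcop⟩ : ∃ α ρ : ℕ, 0 < α ∧ 0 < ρ ∧ q = (α : ℝ) / ρ ∧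
      Nat.Coprime α ρ := by
    obtain ⟨α, ρ, hα, hρ, hqe, -⟩ := hq.exists_fraction
    obtain ⟨a, r, hcop, ha, hr⟩ := Nat.exists_coprime α ρ
    have hgcd : 0 < α.gcd ρ := Nat.gcd_pos_of_pos_left _ hα
    refine ⟨a, r, Nat.pos_of_mul_pos_right (ha ▸ hα), Nat.pos_of_mul_pos_right (hr ▸ hρ),
      ?_, hcop⟩
    generalize α.gcd ρ = g at ha hr hgcd
    have : (0 : ℝ) < g := by exact_mod_cast hgcd
    rw [hqe, ha, hr]
    push_cast
    rw [mul_div_mul_right _ _ this.ne']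
  set D := weightDen I with hDdef
  have hD : 0 < D := weightDen_pos I
  have hD' : (0 : ℝ) < D := by exact_mod_cast hD
  have hα' : (0 : ℝ) < α := by exact_mod_cast hα
  have hρ' : (0 : ℝ) < ρ := by exact_mod_cast hρ
  have hw (l : Fin n) : ∃ b : ℕ, (I.w l : ℝ) * D = b :=
    exists_nat_of_mem_grid (w_mem_grid I l) (by exact_mod_cast I.w_nonneg l)
  choose b hb using hw
  set c := α * D with hc
  have hc0 : 0 < c := Nat.mul_pos hα hD
  have hc' : (c : ℝ) = q * (ρ * D) := by rw [hc, hqe]; push_cast; field_simp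
  have hbq (l : Fin n) : ((b l * ρ : ℕ) : ℝ) = I.w l / q * c := by
    have := hq.1.1
    push_cast
    rw [← hb, hc']
    field_simp
  set r : Fin n → Finset (Fin n) := fun i => U.filter fun l => I.Reaches i l with hr
  obtain ⟨P, dst, hPcard, hPr, hPb⟩ := exists_unit_assignment (F := I.avail U) (c := c)
    (b := fun l => b l * ρ) hm.le r (by
      intro F' hF' hne
      set X := F'.biUnion r with hX
      have hXc : SuccClosed I U X := by
        constructor
        · exact Finset.biUnion_subset.2 fun i _ => Finset.filter_subset _ _
        · intro j hj k hk hjk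
          obtain ⟨i, hi, hij⟩ := Finset.mem_biUnion.1 hj
          exact Finset.mem_biUnion.2 ⟨i, hi,
            Finset.mem_filter.2 ⟨hk, (Finset.mem_filter.1 hij).2.tail hjk⟩⟩
      have hcut := (isMinCut_singleton_iff hq.1.1).1 hq.1.2 X hXc
      have hF'X : F' ⊆ X := fun i hi => Finset.mem_biUnion.2
        ⟨i, hi, Finset.mem_filter.2 ⟨mem_of_mem_avail (hF' hi), Relation.ReflTransGen.refl⟩⟩
      have hcard : (I.avail U \ X).card + F'.card ≤ (I.avail U).card := by
        rw [← Finset.card_sdiff_add_card_eq_card hF']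
        have := Finset.card_le_card (Finset.sdiff_subset_sdiff (subset_refl (I.avail U)) hF'X)
        omega
      have hsum : ((∑ l ∈ X, b l * ρ : ℕ) : ℝ) = totalWeight I X * (ρ * D) := by
        rw [totalWeight, Finset.sum_mul]
        push_cast
        refine Finset.sum_congr rfl fun l _ => ?_
        rw [← hb]
        ring
      have hcard' : ((I.avail U \ X).card : ℝ) + F'.card ≤ (I.avail U).card := by
        exact_mod_cast hcard
      have hsub : (((I.avail U).card - I.m : ℕ) : ℝ) = (I.avail U).card - I.m :=
        Nat.cast_sub hm.le
      have goal : (F'.card : ℝ) * c ≤ totalWeight I X * (ρ * D) +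
          ((I.avail U).card - I.m) * c := by
        have h1 : (I.m : ℝ) - (I.avail U \ X).card ≥ I.m + F'.card - (I.avail U).card := by
          linarith
        have h2 := mul_le_mul_of_nonneg_right hcut (mul_nonneg hρ'.le hD'.le)
        have h3 := mul_le_mul_of_nonneg_right h1 (Nat.cast_nonneg (α := ℝ) c)
        have h4 : q * ((I.m : ℝ) - (I.avail U \ X).card) * (ρ * D) =
            ((I.m : ℝ) - (I.avail U \ X).card) * c := by
          rw [hc']; ring
        linarith
      rw [← hsum, ← hsub] at goal
      exact_mod_cast goal)
  have hpath : ∀ u : I.avail U × Fin c, ∃ g : Fin n × Fin n → ℕ, u ∈ P → ∀ v,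
      ∑ e ∈ (precOn I U).filter (fun e => e.2 = v), g e + (if (u.1 : Fin n) = v then 1 else 0) =
        ∑ e ∈ (precOn I U).filter (fun e => e.1 = v), g e + if dst u = v then 1 else 0 := by
    intro u
    by_cases hu : u ∈ P
    · obtain ⟨g, hg⟩ := exists_path_flow hU (mem_of_mem_avail u.1.2)
        (Finset.mem_filter.1 (hPr u hu)).2
      exact ⟨g, fun _ => hg⟩
    · exact ⟨0, fun h => absurd h hu⟩
  choose g hg using hpath
  have hflow := isFlow_unitFlow hc0 hPcard.le
    (fun l => by rw [← hbq l]; exact_mod_cast hPb l) hg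
  have hval : flowValue I U (fun a => (unitFlow P dst g a : ℝ) / c) = I.m := by
    rw [flowValue_eq]
    change (P.card : ℝ) / c = I.m
    have : (0 : ℝ) < c := by exact_mod_cast hc0
    rw [hPcard]
    push_cast
    field_simp
  refine ⟨_, ⟨hflow, fun y hy => ?_⟩, ?_, hval⟩
  · rw [hval, flowValue_eq]
    exact hy.ab_le
  · intro α' ρ' hρ'0 hq' a _
    -- as `α / ρ` is in lowest terms, `α` divides the numerator of every other representation
    have hdvd : α ∣ α' := by
      have h1 : (α : ℝ) * ρ' = α' * ρ := by
        have h2 : (0 : ℝ) < ρ' := by exact_mod_cast hρ'0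
        rw [hqe] at hq'
        field_simp at hq'
        linarith
      have h1' : α * ρ' = α' * ρ := by exact_mod_cast h1
      exact hcop.dvd_of_dvd_mul_right (h1' ▸ Dvd.intro _ rfl)
    have hmem : (unitFlow P dst g a : ℝ) / c ∈ grid c := by
      have : (0 : ℝ) < c := by exact_mod_cast hc0
      exact ⟨unitFlow P dst g a, by push_cast; field_simp⟩
    obtain ⟨z, hz⟩ := grid_mono (Nat.mul_dvd_mul_right hdvd D) hmem
    exact ⟨z, by rw [← hz]; push_cast; rfl⟩

end Existence

/-! ### Carrying out the loop -/

section Run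

variable {n : ℕ} {I : Inst n} {U : Finset (Fin n)}

theorem exists_avail_reaches {j : Fin n} (hj : j ∈ U) : ∃ i ∈ I.avail U, I.Reaches i j := by
  have hwf : WellFounded (Relation.TransGen fun a b => (a, b) ∈ I.prec) := by
    have : Std.Irrefl (Relation.TransGen fun a b => (a, b) ∈ I.prec) := ⟨I.acyclic⟩
    exact Finite.wellFounded_of_trans_of_irrefl _
  induction j using hwf.induction with
  | _ j ih =>
    by_cases h : j ∈ I.avail U
    · exact ⟨j, h, Relation.ReflTransGen.refl⟩
    · have : ∃ i ∈ U, (i, j) ∈ I.prec := by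
        by_contra! hno
        exact h (Finset.mem_filter.2 ⟨hj, hno⟩)
      obtain ⟨i, hi, hij⟩ := this
      obtain ⟨l, hl, hli⟩ := ih i (Relation.TransGen.single hij) hi
      exact ⟨l, hl, hli.tail hij⟩

theorem SuccClosed.erase (hU : SuccClosed I Finset.univ U) {i : Fin n} (hi : i ∈ I.avail U) :
    SuccClosed I Finset.univ (U.erase i) := by
  refine ⟨Finset.subset_univ _, fun j hj k hk hjk => ?_⟩
  have hjU := Finset.mem_of_mem_erase hj
  refine Finset.mem_erase.2 ⟨?_, hU.2 j hjU k hk hjk⟩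
  rintro rfl
  exact (Finset.mem_filter.1 hi).2 j hjU hjk

/-- The clock, the unfinished jobs and the elapsed processing times at the beginning of an
iteration. -/
structure LoopState (n : ℕ) where
  t : ℝ
  U : Finset (Fin n)
  Y : Fin n → ℝ

/-- The job `j` may be completed next if the rates are `r`. -/
structure IsNext (I : Inst n) (r : Fin n → ℝ) (s : LoopState n) (j : Fin n) : Prop where
  mem : j ∈ I.avail s.U
  pos : 0 < r j
  min : ∀ i ∈ I.avail s.U, 0 < r i → ((I.p j : ℝ) - s.Y j) / r j ≤ ((I.p i : ℝ) - s.Y i) / r i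

/-- The state after an iteration with rates `r` that completes the job `j`. -/
noncomputable def LoopState.advance (I : Inst n) (r : Fin n → ℝ) (s : LoopState n) (j : Fin n) :
    LoopState n where
  t := s.t + ((I.p j : ℝ) - s.Y j) / r j
  U := s.U.erase j
  Y i := if i ∈ I.avail s.U then s.Y i + r i * (((I.p j : ℝ) - s.Y j) / r j) else s.Y i

open Classical in
/-- The states of the loop for a rule `R` that gives the rates in terms of the iteration and the
set of unfinished jobs. The state does not change any more once no job can be completed. -/
noncomputable def loopState (I : Inst n) (R : ℕ → Finset (Fin n) → Fin n → ℝ) : ℕ → LoopState n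
  | 0 => ⟨0, Finset.univ, fun _ => 0⟩
  | k + 1 =>
    let s := loopState I R k
    if h : ∃ j, IsNext I (R k s.U) s j then s.advance I (R k s.U) h.choose else s

/-- If some available job always has a positive rate, the loop can be carried out to the end. -/
theorem exists_complete_trace (R : ℕ → Finset (Fin n) → Fin n → ℝ)
    (hR : ∀ k U, SuccClosed I Finset.univ U → U.Nonempty → ∃ i ∈ I.avail U, 0 < R k U i) :
    ∃ T : Trace n, ObeysLoop I T ∧ T.Complete ∧ (∀ k, T.R k = R k (T.U k)) ∧
      ∀ k < T.len, SuccClosed I Finset.univ (T.U k) := by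
  classical
  set S := loopState I R with hS
  have hnext : ∀ k, SuccClosed I Finset.univ (S k).U → (S k).U.Nonempty →
      ∃ j, IsNext I (R k (S k).U) (S k) j ∧
        S (k + 1) = (S k).advance I (R k (S k).U) j := by
    intro k hc hne
    have hex : ∃ j, IsNext I (R k (S k).U) (S k) j := by
      obtain ⟨i, hi, hpos⟩ := hR k _ hc hne
      obtain ⟨j, hj, hmin⟩ := Finset.exists_min_image
        ((I.avail (S k).U).filter fun i => 0 < R k (S k).U i)
        (fun i => ((I.p i : ℝ) - (S k).Y i) / R k (S k).U i)
        ⟨i, Finset.mem_filter.2 ⟨hi, hpos⟩⟩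
      obtain ⟨hj1, hj2⟩ := Finset.mem_filter.1 hj
      exact ⟨j, hj1, hj2, fun i hi hpos => hmin i (Finset.mem_filter.2 ⟨hi, hpos⟩)⟩
    refine ⟨hex.choose, hex.choose_spec, ?_⟩
    exact dif_pos hex
  have hinv : ∀ k ≤ n, SuccClosed I Finset.univ (S k).U ∧ (S k).U.card + k = n := by
    intro k
    induction k with
    | zero =>
      intro _
      refine ⟨succClosed_self, ?_⟩
      change (Finset.univ : Finset (Fin n)).card + 0 = n
      simp
    | succ k ih =>
      intro hk
      obtain ⟨hc, hcard⟩ := ih (by omega)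
      obtain ⟨j, hj, hj'⟩ := hnext k hc (Finset.card_pos.1 (by omega))
      rw [hj']
      refine ⟨hc.erase hj.mem, ?_⟩
      have := Finset.card_erase_add_one (mem_of_mem_avail hj.mem)
      change ((S k).U.erase j).card + (k + 1) = n
      omega
  have hjob : ∀ k : Fin n, ∃ j, IsNext I (R k (S k).U) (S k) j ∧
      S (k + 1) = (S k).advance I (R k (S k).U) j := by
    intro k
    obtain ⟨hc, hcard⟩ := hinv k k.2.le
    exact hnext k hc (Finset.card_pos.1 (by omega))
  choose job hjob hstep using hjob
  have hinj : Function.Injective job := injective_of_erase (U := fun k => (S k).U)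
    (fun k => mem_of_mem_avail (hjob k).mem) (fun k => by simp only [hstep k]; rfl)
  refine ⟨⟨n, fun k => (S k).t, fun k => (S k).U, fun k => (S k).Y, fun k => R k (S k).U, job,
    Function.extend job (fun k => (S (k + 1)).t) 0⟩, ?_, ?_, fun k => rfl,
    fun k hk => (hinv k (le_of_lt hk)).1⟩
  · exact
      { t_zero := rfl
        U_zero := rfl
        Y_zero := fun _ => rfl
        job_mem := fun k => (hjob k).mem
        rate_pos := fun k => (hjob k).pos
        job_min := fun k => (hjob k).min
        Y_avail := fun k i hi => by
          change (S (k + 1)).Y i = _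
          rw [hstep k]
          exact if_pos hi
        Y_other := fun k i hi => by
          change (S (k + 1)).Y i = _
          rw [hstep k]
          exact if_neg hi
        t_succ := fun k => by
          change (S (k + 1)).t = _
          rw [hstep k]
          rfl
        U_succ := fun k => by
          change (S (k + 1)).U = _
          rw [hstep k]
          rfl
        C_job := fun k => hinj.extend_apply (fun k : Fin n => (S (k + 1)).t) 0 k }
  · have := (hinv n le_rfl).2
    exact Finset.card_eq_zero.1 (show (S n).U.card = 0 by omega)

theorem exists_complete_parallelRun (hw : ∀ j, ∃ k, I.Reaches j k ∧ 0 < I.w k) :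
    ∃ T : ParallelRun I, T.Complete := by
  have hex : ∀ U : Finset (Fin n), ∃ (q : ℝ) (x : Node n × Node n → ℝ),
      SuccClosed I Finset.univ U → I.m < (I.avail U).card →
        IsPrice I U q ∧ IsMaxFlow I U q x ∧ IsIntegralFlow I U q x ∧ flowValue I U x = I.m := by
    intro U
    by_cases h : SuccClosed I Finset.univ U ∧ I.m < (I.avail U).card
    · obtain ⟨q, hq⟩ := exists_isPrice_of_reaches hw h.1 h.2
      obtain ⟨x, hx⟩ := hq.exists_integral_flow h.1 h.2
      exact ⟨q, x, fun _ _ => ⟨hq, hx⟩⟩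
    · exact ⟨0, fun _ => 0, fun h1 h2 => absurd ⟨h1, h2⟩ h⟩
  choose q x hqx using hex
  obtain ⟨T, hT, hc, hrate, hclosed⟩ := exists_complete_trace (I := I)
    (fun _ U i => if (I.avail U).card ≤ I.m then 1 else x U (Node.B, Node.job i)) (by
      intro _ U hU hne
      obtain ⟨j, hj⟩ := hne
      obtain ⟨i, hi, -⟩ := exists_avail_reaches (I := I) hj
      rcases Nat.lt_or_ge I.m (I.avail U).card with hm | hm
      · simp only [hm.not_ge, if_false]
        obtain ⟨-, hx, -, hval⟩ := hqx U hU hm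
        have hB := hx.1.conservation Node.B (by simp [nodes]) (by simp) (by simp)
        rw [sum_arcs_into_B, sum_arcs_out_of_B, ← flowValue_eq (I := I) (x U), hval] at hB
        have hm0 : (0 : ℝ) < I.m := by exact_mod_cast I.m_pos
        by_contra! hno
        linarith [Finset.sum_nonpos hno]
      · exact ⟨i, hi, by simp only [hm, if_true, zero_lt_one]⟩)
  refine ⟨{ toTrace := T
            price := fun k => q (T.U k)
            flow := fun k => x (T.U k)
            obeys := hT
            rate_few := fun k _ hm i _ => ?_
            price_spec := fun k hk hm => (hqx _ (hclosed k hk) hm).1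
            flow_max := fun k hk hm => (hqx _ (hclosed k hk) hm).2.1
            flow_integral := fun k hk hm => (hqx _ (hclosed k hk) hm).2.2.1
            rate_many := fun k _ hm i _ => ?_ }, hc⟩
  · rw [hrate k]; exact if_pos hm
  · rw [hrate k]; exact if_neg hm.not_ge

/-! ### The algorithm for a single machine -/

theorem exists_complete_singleRun {rule : ℕ → Finset (Fin n) → Fin n → Finset (Fin n)}
    (hrule : ∀ k U, SuccClosed I Finset.univ U → U.Nonempty →
      ∃ i ∈ I.avail U, 0 < totalWeight I (rule k U i) ∧ 0 < totalWeight I U) :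
    ∃ T : SingleRun I rule, T.Complete := by
  obtain ⟨T, hT, hc, hrate, -⟩ := exists_complete_trace (I := I)
    (fun k U i => totalWeight I (rule k U i) / totalWeight I U) (fun k U hU hne => by
      obtain ⟨i, hi, h1, h2⟩ := hrule k U hU hne
      exact ⟨i, hi, div_pos h1 h2⟩)
  exact ⟨{ toTrace := T, obeys := hT, rate := fun k _ i _ => by rw [hrate k] }, hc⟩

theorem exists_mem_greedyTree (e : Equiv.Perm (Fin n)) {j : Fin n} (hj : j ∈ U) :
    ∃ i ∈ I.avail U, j ∈ greedyTree I e U i := by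
  classical
  obtain ⟨i, hi, hij⟩ := exists_avail_reaches (I := I) hj
  obtain ⟨l, hl, hmin⟩ := Finset.exists_min_image ((I.avail U).filter fun i => I.Reaches i j) e
    ⟨i, Finset.mem_filter.2 ⟨hi, hij⟩⟩
  obtain ⟨hl1, hl2⟩ := Finset.mem_filter.1 hl
  refine ⟨l, hl1, ?_⟩
  unfold greedyTree
  simp only [Finset.mem_filter]
  exact ⟨hj, hl2, fun a ha hlt hr => (hmin a (Finset.mem_filter.2 ⟨ha, hr⟩)).not_gt hlt⟩

theorem exists_complete_greedy (hw : ∀ j, ∃ k, I.Reaches j k ∧ 0 < I.w k)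
    {rule : ℕ → Finset (Fin n) → Fin n → Finset (Fin n)} (hrule : IsGreedyRule I rule) :
    ∃ T : SingleRun I rule, T.Complete := by
  obtain ⟨e, he⟩ := hrule
  refine exists_complete_singleRun fun k U hU hne => ?_
  obtain ⟨j, hj⟩ := hne
  obtain ⟨l, hjl, hl⟩ := hw j
  have hlU := hU.mem_of_reaches hj hjl
  obtain ⟨i, hi, hli⟩ := exists_mem_greedyTree (I := I) (e k) hlU
  exact ⟨i, hi, by rw [he]; exact totalWeight_pos_of_mem hli hl, totalWeight_pos_of_mem hlU hl⟩

/-- A visit only adds visited nodes, does not change the subtrees of the nodes visited before, and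
puts every newly visited node into its own subtree. -/
structure DfsExtends (s s' : Finset (Fin n) × (Fin n → Finset (Fin n))) : Prop where
  subset : s.1 ⊆ s'.1
  eq_of_mem : ∀ u ∈ s.1, s'.2 u = s.2 u
  self_mem : ∀ u ∈ s'.1, u ∉ s.1 → u ∈ s'.2 u

theorem DfsExtends.refl (s : Finset (Fin n) × (Fin n → Finset (Fin n))) : DfsExtends s s :=
  ⟨subset_rfl, fun _ _ => rfl, fun _ h h' => absurd h h'⟩

theorem DfsExtends.trans {a b c : Finset (Fin n) × (Fin n → Finset (Fin n))}
    (hab : DfsExtends a b) (hbc : DfsExtends b c) : DfsExtends a c := by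
  refine ⟨hab.subset.trans hbc.subset,
    fun u hu => (hbc.eq_of_mem u (hab.subset hu)).trans (hab.eq_of_mem u hu), fun u hc ha => ?_⟩
  by_cases hb : u ∈ b.1
  · rw [hbc.eq_of_mem u hb]; exact hab.self_mem u hb ha
  · exact hbc.self_mem u hc hb

theorem DfsExtends.foldl {v : Fin n → Finset (Fin n) × (Fin n → Finset (Fin n)) →
      Finset (Fin n) × (Fin n → Finset (Fin n))} (hv : ∀ c s, DfsExtends s (v c s))
    (l : List (Fin n)) (s : Finset (Fin n) × (Fin n → Finset (Fin n))) :
    DfsExtends s (l.foldl (fun s' c => v c s') s) := by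
  induction l generalizing s with
  | nil => exact DfsExtends.refl s
  | cons c l ih => exact (hv c s).trans (ih _)

theorem dfsExtends_dfsVisit (adj : Fin n → List (Fin n)) (f : ℕ) (v : Fin n)
    (s : Finset (Fin n) × (Fin n → Finset (Fin n))) : DfsExtends s (dfsVisit adj f v s) := by
  induction f generalizing v s with
  | zero => exact DfsExtends.refl s
  | succ f ih =>
    unfold dfsVisit
    split_ifs with hv
    · exact DfsExtends.refl s
    · have hr := DfsExtends.foldl (v := fun c s' => dfsVisit adj f c s') (fun c s => ih c s)
        (adj v) (insert v s.1, s.2)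
      set r := (adj v).foldl (fun s' c => dfsVisit adj f c s') (insert v s.1, s.2)
      have hvr : v ∈ r.1 := hr.subset (Finset.mem_insert_self _ _)
      refine ⟨(Finset.subset_insert _ _).trans hr.subset, fun u hu => ?_, fun u hu hus => ?_⟩
      · have huv : u ≠ v := fun h => hv (h ▸ hu)
        simp only [Function.update_of_ne huv]
        exact hr.eq_of_mem u (Finset.mem_insert_of_mem hu)
      · by_cases huv : u = v
        · subst huv
          simp only [Function.update_self]
          exact Finset.mem_sdiff.2 ⟨hvr, hv⟩
        · simp only [Function.update_of_ne huv]
          exact hr.self_mem u hu fun h => (Finset.mem_insert.1 h).elim huv hus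

theorem mem_dfsVisit (adj : Fin n → List (Fin n)) (f : ℕ) (v : Fin n)
    (s : Finset (Fin n) × (Fin n → Finset (Fin n))) : v ∈ (dfsVisit adj (f + 1) v s).1 := by
  unfold dfsVisit
  split_ifs with hv
  · exact hv
  · exact (DfsExtends.foldl (v := fun c s' => dfsVisit adj f c s')
      (fun c s => dfsExtends_dfsVisit adj f c s) (adj v) (insert v s.1, s.2)).subset
      (Finset.mem_insert_self _ _)

theorem mem_dfsSubtree_self {roots : List (Fin n)} (adj : Fin n → List (Fin n)) {v : Fin n}
    (hv : v ∈ roots) : v ∈ dfsSubtree roots adj v := by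
  obtain ⟨f, hf⟩ : ∃ f, n = f + 1 := ⟨n - 1, by have := v.2; omega⟩
  have hext : ∀ (l : List (Fin n)) s, DfsExtends s (l.foldl (fun s r => dfsVisit adj n r s) s) :=
    fun l s => DfsExtends.foldl (v := fun c s' => dfsVisit adj n c s')
      (fun c s => dfsExtends_dfsVisit adj n c s) l s
  have hvis : ∀ s, v ∈ (roots.foldl (fun s r => dfsVisit adj n r s) s).1 := by
    intro s
    obtain ⟨l₁, l₂, rfl⟩ := List.append_of_mem hv
    rw [List.foldl_append, List.foldl_cons]
    refine (hext _ _).subset ?_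
    have := mem_dfsVisit adj f v (l₁.foldl (fun s r => dfsVisit adj n r s) s)
    rwa [← hf] at this
  exact (hext roots (∅, fun _ => ∅)).self_mem v (hvis _) (Finset.notMem_empty v)

theorem exists_complete_dfs (hw : ∀ j, 0 < I.w j)
    {rule : ℕ → Finset (Fin n) → Fin n → Finset (Fin n)} (hrule : IsDfsRule I rule) :
    ∃ T : SingleRun I rule, T.Complete := by
  obtain ⟨roots, adj, hroots, -, he⟩ := hrule
  refine exists_complete_singleRun fun k U _ hne => ?_
  obtain ⟨j, hj⟩ := hne
  obtain ⟨i, hi, -⟩ := exists_avail_reaches (I := I) hj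
  exact ⟨i, hi,
    by rw [he]; exact totalWeight_pos_of_mem (mem_dfsSubtree_self adj (hroots i)) (hw i),
    totalWeight_pos_of_mem hj (hw j)⟩

section Bounds

variable {rule : ℕ → Finset (Fin n) → Fin n → Finset (Fin n)}

theorem encodedWithin_totalWeight (J : Finset (Fin n)) :
    EncodedWithin (lenBound I.encLen) (totalWeight I J) := by
  refine (encodedWithin_of_mem_grid (c := 2 * I.encLen) (weightDen_pos I) (weightDen_le I) ?_
    (totalWeight_mem_grid I J)).mono (by unfold lenBound; omega)
  rw [abs_of_nonneg (totalWeight_nonneg I J)]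
  exact totalWeight_le I J

/-- The rates `W(i) / W` have the common denominator `D * W`, where `D` is the common denominator
of the weights. -/
theorem SingleRun.ratesWithin (T : SingleRun I rule) :
    T.toTrace.RatesWithin I (4 * I.encLen) := by
  intro k hk
  have hDle : (weightDen I : ℝ) ≤ 2 ^ I.encLen := by exact_mod_cast weightDen_le I
  have hnum (J : Finset (Fin n)) : totalWeight I J * weightDen I ≤ 2 ^ (4 * I.encLen) := by
    calc totalWeight I J * weightDen I ≤ 2 ^ (2 * I.encLen) * 2 ^ I.encLen := by
          gcongr
          exact totalWeight_le I J
      _ = 2 ^ (3 * I.encLen) := by rw [← pow_add]; congr 1; ring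
      _ ≤ 2 ^ (4 * I.encLen) := pow_le_pow_right₀ (by norm_num) (by omega)
  have hW : 0 < totalWeight I (T.U k) := by
    have h1 := T.obeys.rate_pos ⟨k, hk⟩
    rw [T.rate k hk _ (T.obeys.job_mem ⟨k, hk⟩)] at h1
    -- if the total weight were `0`, then so would be all rates, because `a / 0 = 0`
    refine lt_of_le_of_ne (totalWeight_nonneg I _) fun h0 => ?_
    simp only [← h0, div_zero, lt_self_iff_false] at h1
  have hD : (0 : ℝ) < weightDen I := by exact_mod_cast weightDen_pos I
  obtain ⟨N, hN⟩ := exists_nat_of_mem_grid (totalWeight_mem_grid I (T.U k)) hW.le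
  have hN0 : (0 : ℝ) < N := hN ▸ mul_pos hW hD
  have hmul (J : Finset (Fin n)) :
      totalWeight I J / totalWeight I (T.U k) * N = totalWeight I J * weightDen I := by
    rw [← hN]; field_simp
  refine ⟨N, by exact_mod_cast hN0, ?_, fun i hi => ?_⟩
  · have := hnum (T.U k)
    rw [hN] at this
    exact_mod_cast this
  · rw [T.rate k hk i hi]
    refine ⟨div_nonneg (totalWeight_nonneg I _) hW.le, ?_, ?_⟩
    · obtain ⟨z, hz⟩ := totalWeight_mem_grid I (rule k (T.U k) i)
      exact ⟨z, by rw [hmul, hz]⟩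
    · rw [hmul]; exact hnum _

theorem SingleNumber.encodedWithin {T : SingleRun I rule} {a : ℝ} (ha : SingleNumber T a) :
    EncodedWithin (lenBound I.encLen) a := by
  cases ha with
  | loop a ha => exact ha.encodedWithin T.ratesWithin T.obeys
  | total k hk => exact encodedWithin_totalWeight _
  | subtree k hk i => exact encodedWithin_totalWeight _

theorem encodedWithin_listCompletion (σ : Equiv.Perm (Fin n)) (j : Fin n) :
    EncodedWithin (lenBound I.encLen) (listCompletion I σ j) := by
  have h0 : 0 ≤ listCompletion I σ j :=
    Finset.sum_nonneg fun k _ => by exact_mod_cast I.p_nonneg _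
  refine (encodedWithin_of_mem_grid (c := I.encLen + I.encLen) (procDen_pos I) (procDen_le I) ?_
    (sum_mem fun k _ => p_mem_grid I (σ k))).mono (by unfold lenBound; omega)
  change |listCompletion I σ j| ≤ _
  rw [abs_of_nonneg h0]
  exact sum_le_two_pow I (fun k => p_le I (σ k)) _

end Bounds

end Run

open Polynomial in
theorem eval_lenBound (L : ℕ) :
    ((40 : ℕ[X]) * X ^ 2 + 40 * X + 40).eval L = lenBound L := by
  simp [lenBound, pow_two]

end PrecSched

theorem mainTheorem5 :
    (∃ P : Polynomial ℕ, ∀ (n : ℕ) (I : PrecSched.Inst n),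
      -- the algorithm for identical parallel machines
      (∀ T : PrecSched.ParallelRun I,
        T.len ≤ n ∧
        (∀ a : ℝ, PrecSched.ParallelNumber T a →
          PrecSched.EncodedWithin (P.eval I.encLen) a) ∧
        (T.Complete → ∀ σ : Equiv.Perm (Fin n), Monotone (T.C ∘ σ) →
          (∀ j : Fin n, n ≤ (PrecSched.wrapState T.toTrace σ j (2 * n)).k) ∧
          ∀ a : ℝ, PrecSched.WrapNumber T.toTrace σ a →
            PrecSched.EncodedWithin (P.eval I.encLen) a)) ∧
      -- the algorithm for a single machine
      (∀ rule : ℕ → Finset (Fin n) → Fin n → Finset (Fin n),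
        PrecSched.IsDfsRule I rule ∨ PrecSched.IsGreedyRule I rule →
        ∀ T : PrecSched.SingleRun I rule,
          T.len ≤ n ∧
          (∀ a : ℝ, PrecSched.SingleNumber T a →
            PrecSched.EncodedWithin (P.eval I.encLen) a) ∧
          (T.Complete → ∀ σ : Equiv.Perm (Fin n), Monotone (T.C ∘ σ) →
            ∀ j : Fin n, PrecSched.EncodedWithin (P.eval I.encLen)
              (PrecSched.listCompletion I σ j)))) ∧
    -- the algorithms can be carried out to the end
    (∀ (n : ℕ) (I : PrecSched.Inst n),
      ((∀ j, ∃ k, I.Reaches j k ∧ 0 < I.w k) →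
        (∃ T : PrecSched.ParallelRun I, T.Complete) ∧
        ∀ rule : ℕ → Finset (Fin n) → Fin n → Finset (Fin n), PrecSched.IsGreedyRule I rule →
          ∃ T : PrecSched.SingleRun I rule, T.Complete) ∧
      ((∀ j, 0 < I.w j) →
        ∀ rule : ℕ → Finset (Fin n) → Fin n → Finset (Fin n), PrecSched.IsDfsRule I rule →
          ∃ T : PrecSched.SingleRun I rule, T.Complete)) := by
  refine ⟨⟨40 * Polynomial.X ^ 2 + 40 * Polynomial.X + 40, fun n I => ?_⟩, fun n I => ?_⟩
  · rw [PrecSched.eval_lenBound]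
    refine ⟨fun T => ⟨T.obeys.len_le, fun a ha => ha.encodedWithin, fun hc σ hσ =>
      ⟨fun j => T.wrap_terminates hc hσ j, fun a ha => ha.encodedWithin hc hσ⟩⟩,
      fun rule _ T => ⟨T.obeys.len_le, fun a ha => ha.encodedWithin,
        fun _ σ _ j => PrecSched.encodedWithin_listCompletion σ j⟩⟩
  · exact ⟨fun hw => ⟨PrecSched.exists_complete_parallelRun hw,
      fun rule hrule => PrecSched.exists_complete_greedy hw hrule⟩,
      fun hw rule hrule => PrecSched.exists_complete_dfs hw hrule⟩
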